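/- Let $d,m\ge 1$ be integers and $\epsilon>0$. There is a constant $C$, depending only on $\epsilon$, $d$ and $m$, such that the following holds. Let $\mathcal H$ be a Hilbert space of dimension $d$, let $\rho$ be a density operator on $\mathcal H$ with $\rho>0$ (for instance the average state $\sum_i p_i|\psi_i\rangle\langle\psi_i|$ of an ensemble spanning $\mathcal H$), and let $\mathbf a=(a_j)_{j=1,\dots,m}$ be a POVM on $\mathcal H$, i.e. $a_j\ge 0$ and $\sum_j a_j=\mathbb 1$. Put $$\lambda_j=\operatorname{Tr}(\rho a_j),\qquad \hat\rho_j=\frac{1}{\lambda_j}\sqrt\rho\,a_j\sqrt\rho ,$$ and let $H(\sigma)=-\operatorname{Tr}\sigma\log\sigma$ denote the von Neumann entropy (terms with $\lambda_j=0$ are omitted from the sum below). Then for every $l$ there is a POVM $\mathbf A=(A_\mu)_{\mu=1,\dots,M}$ on $\mathcal H^{\otimes l}$, whose outcomes $\mu$ are labelled by words $j^l_\mu=(j_{\mu 1},\dots,j_{\mu l})\in\{1,\dots,m\}^l$, with $$M\le\exp\Bigl(l\Bigl(H(\rho)-\sum_j\lambda_jH(\hat\rho_j)\Bigr)+C\sqrt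 l\Bigr)$$ outcomes, such that its marginals $$A^{(k)}_j=\operatorname{Tr}_{\neq k}\Bigl(\bigl(\rho^{\otimes[l]\setminus k}\otimes\mathbb 1_k\bigr)\sum_{\mu:\ j_{\mu k}=j}A_\mu\Bigr)$$ ($\operatorname{Tr}_{\ne k}$ being the partial trace over all tensor factors but the $k$-th) satisfy, in the operator norm, $$\sum_{j=1}^m\|A^{(k)}_j-a_j\|\le\epsilon\qquad\text{for every }k=1,\dots,l .$$ -/

import Mathlib

open scoped ComplexOrder

noncomputable section

namespace POVMCompression

/-- A density operator of full rank: `ρ > 0` and `Tr ρ = 1`. -/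
structure IsFaithfulState {n : Type} [Fintype n] (ρ : Matrix n n ℂ) : Prop where
  posDef : ρ.PosDef
  trace_eq_one : ρ.trace = 1

/-- A POVM with outcome set `ι`. -/
structure IsPOVM {ι n : Type} [Fintype ι] [Fintype n] [DecidableEq n]
    (a : ι → Matrix n n ℂ) : Prop where
  posSemidef : ∀ j, (a j).PosSemidef
  sum_eq_one : ∑ j, a j = 1

/-- The von Neumann entropy `-Tr (ρ log ρ)` (natural logarithm, `0 log 0 = 0`). -/
def entropy {n : Type} [Fintype n] [DecidableEq n] (ρ : Matrix n n ℂ) : ℝ :=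
  (cfc Real.negMulLog ρ).trace.re

/-- The outcome probability `λ_j = Tr (ρ a_j)`. -/
def outcomeProb {ι n : Type} [Fintype n] (ρ : Matrix n n ℂ) (a : ι → Matrix n n ℂ) (j : ι) : ℝ :=
  (ρ * a j).trace.re

/-- The state `√ρ a_j √ρ / λ_j` of the canonical ensemble. If `λ_j = 0` this is the zero matrix,
which only ever enters multiplied by `λ_j`. -/
def canonicalState {ι n : Type} [Fintype n] [DecidableEq n]
    (ρ : Matrix n n ℂ) (a : ι → Matrix n n ℂ) (j : ι) : Matrix n n ℂ :=
  (outcomeProb ρ a j)⁻¹ • (cfc Real.sqrt ρ * a j * cfc Real.sqrt ρ)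

/-- The entropy defect `H(ρ) - ∑_j λ_j H(ρ̂_j)`. -/
def entropyDefect {ι n : Type} [Fintype ι] [Fintype n] [DecidableEq n]
    (ρ : Matrix n n ℂ) (a : ι → Matrix n n ℂ) : ℝ :=
  entropy ρ - ∑ j, outcomeProb ρ a j * entropy (canonicalState ρ a j)

/-- The tensor product `F_1 ⊗ ⋯ ⊗ F_l`, as a matrix in the product basis, whose elements are
indexed by the words `Fin l → Fin d`. -/
def tensor {l d : ℕ} (F : Fin l → Matrix (Fin d) (Fin d) ℂ) :
    Matrix (Fin l → Fin d) (Fin l → Fin d) ℂ :=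
  Matrix.of fun x y => ∏ i, F i (x i) (y i)

/-- The partial trace `Tr_{≠ k}` over all tensor factors except the `k`-th. -/
def partialTraceExcept {l d : ℕ} (k : Fin l)
    (X : Matrix (Fin l → Fin d) (Fin l → Fin d) ℂ) : Matrix (Fin d) (Fin d) ℂ :=
  Matrix.of fun s t => ∑ z : {i : Fin l // i ≠ k} → Fin d,
    X ((Equiv.funSplitAt k (Fin d)).symm (s, z)) ((Equiv.funSplitAt k (Fin d)).symm (t, z))

/-- The marginal `A^{(k)}_j = Tr_{≠ k} ((ρ^{⊗ [l] ∖ k} ⊗ 1_k) ∑_{μ : j_{μ k} = j} A_μ)` of a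
measurement `A` whose outcome `μ` is labelled by the word `w μ = (j_{μ 1}, …, j_{μ l})`. -/
def marginal {l d m M : ℕ} (ρ : Matrix (Fin d) (Fin d) ℂ)
    (A : Fin M → Matrix (Fin l → Fin d) (Fin l → Fin d) ℂ) (w : Fin M → Fin l → Fin m)
    (k : Fin l) (j : Fin m) : Matrix (Fin d) (Fin d) ℂ :=
  partialTraceExcept k
    (tensor (Function.update (fun _ => ρ) k 1) * ∑ μ with w μ k = j, A μ)

/-- The operator norm with respect to the Euclidean norm on `ℂ^n`. -/
def opNorm {n : Type} [Fintype n] [DecidableEq n] (X : Matrix n n ℂ) : ℝ :=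
  ‖Matrix.toEuclideanCLM (n := n) (𝕜 := ℂ) X‖

end POVMCompression

end

/-!
Choose `N_j` with `a_j = N_j N_jᴴ` and `N_jᴴ ρ N_j = diag (s j)`. Every `a_{J_1} ⊗ ⋯ ⊗ a_{J_l}` is
then a sum of rank-one operators indexed by words of letters `(j, y)`, on which `ρ^{⊗ l}` gives
independent letters with probabilities `s j y`. Discard the words that are atypical for the
information density, conjugate with the typical projection of `ρ^{⊗ l}`, and divide by
`λ_J = ∏_i λ_{J_i}`. By Chebyshev's inequality this barely changes expectations, and the resulting
`X_J` satisfy `X_J² ≤ B X_J` with `B = exp (l (H(ρ) - ∑_j λ_j H(ρ̂_j)) + O(√l))`.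

Hence the mean of `M` words sampled with distribution `λ` has variance `O(B / M)` in the
Hilbert–Schmidt norm weighted by a state. The states `ρ^{⊗ [l] ∖ k} ⊗ F_k` with `Tr F = 1` are all
dominated by the single operators `ρ^{⊗ [l] ∖ k} ⊗ 1_k`, so only `l m` second moments have to be
controlled at once: `M = B exp (O(√l))` samples suffice, and no operator Chernoff bound over the
`d^l`-dimensional space is needed. The part of the sample mean above `1` is cut off by a contraction
close to `1`, and the missing mass is given to one extra outcome.

Typicality needs a lower bound on `ρ`, whereas the constant must not depend on `ρ`. So `ρ` is
replaced by the depolarized state with parameter `t = s / l`, which is at least `t / d`: the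
logarithm of this bound is `O(√l)`, expectations move by at most `l t = s`, and `l` times the
entropy defect grows by `O(s log l)`.
-/

noncomputable section

namespace POVMCompression

open Matrix
open scoped MatrixOrder

section Expectation

variable {n : Type*} [Fintype n]

/-- The expectation value `Re Tr (ω A)` of the observable `A` in the state `ω`, as a real linear
functional of `A`. -/
def expect (ω : Matrix n n ℂ) : Matrix n n ℂ →ₗ[ℝ] ℝ :=
  Complex.reLm ∘ₗ traceLinearMap n ℝ ℂ ∘ₗ LinearMap.mulLeft ℝ ω

lemma expect_apply (ω A : Matrix n n ℂ) : expect ω A = (ω * A).trace.re := rfl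

lemma expect_comm (ω A : Matrix n n ℂ) : expect ω A = expect A ω := by
  rw [expect_apply, expect_apply, trace_mul_comm]

lemma exists_conjTranspose_mul_self {A : Matrix n n ℂ} (hA : A.PosSemidef) :
    ∃ B : Matrix n n ℂ, A = Bᴴ * B := by
  classical exact CStarAlgebra.nonneg_iff_eq_star_mul_self.mp hA.nonneg

lemma exists_self_mul_conjTranspose {A : Matrix n n ℂ} (hA : A.PosSemidef) :
    ∃ B : Matrix n n ℂ, A = B * Bᴴ :=
  let ⟨B, hB⟩ := exists_conjTranspose_mul_self hA
  ⟨Bᴴ, by rwa [conjTranspose_conjTranspose]⟩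

lemma trace_mul_nonneg {ω A : Matrix n n ℂ} (hω : ω.PosSemidef) (hA : A.PosSemidef) :
    0 ≤ (ω * A).trace := by
  obtain ⟨B, rfl⟩ := exists_conjTranspose_mul_self hω
  rw [mul_assoc, trace_mul_comm]
  exact (hA.mul_mul_conjTranspose_same B).trace_nonneg

lemma expect_nonneg {ω A : Matrix n n ℂ} (hω : ω.PosSemidef) (hA : A.PosSemidef) :
    0 ≤ expect ω A :=
  (Complex.le_def.1 (trace_mul_nonneg hω hA)).1

lemma expect_mono {ω A B : Matrix n n ℂ} (hω : ω.PosSemidef) (h : A ≤ B) :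
    expect ω A ≤ expect ω B := by
  have := expect_nonneg hω (le_iff.1 h)
  rwa [map_sub, sub_nonneg] at this

lemma expect_mono_left {ω ω' A : Matrix n n ℂ} (hA : A.PosSemidef) (h : ω ≤ ω') :
    expect ω A ≤ expect ω' A := by
  rw [expect_comm ω, expect_comm ω']
  exact expect_mono hA h

lemma expect_smul_left (c : ℝ) (ω A : Matrix n n ℂ) : expect (c • ω) A = c * expect ω A := by
  rw [expect_comm, map_smul, smul_eq_mul, expect_comm]

lemma expect_conj (ω B A : Matrix n n ℂ) : expect ω (B * A * Bᴴ) = expect (Bᴴ * ω * B) A := by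
  rw [expect_apply, expect_apply, ← mul_assoc, trace_mul_comm, ← mul_assoc, ← mul_assoc]

lemma mul_mul_conjTranspose_le {A B : Matrix n n ℂ} (h : A ≤ B) (C : Matrix n n ℂ) :
    C * A * Cᴴ ≤ C * B * Cᴴ :=
  star_right_conjugate_le_conjugate h C

lemma conjTranspose_mul_mul_le {A B : Matrix n n ℂ} (h : A ≤ B) (C : Matrix n n ℂ) :
    Cᴴ * A * C ≤ Cᴴ * B * C :=
  star_left_conjugate_le_conjugate h C

/-- A matrix as a vector of the Hilbert–Schmidt space, in which second moments of matrix-valued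
samples become squared norms. -/
def hsVec : Matrix n n ℂ →ₗ[ℝ] EuclideanSpace ℂ (n × n) where
  toFun A := WithLp.toLp 2 fun q => A q.1 q.2
  map_add' _ _ := rfl
  map_smul' _ _ := rfl

lemma norm_hsVec_sq (A : Matrix n n ℂ) : ‖hsVec A‖ ^ 2 = (A * Aᴴ).trace.re := by
  have h_entry (i j : n) : (hsVec A) (i, j) = A i j := rfl
  simp [h_entry, EuclideanSpace.norm_sq_eq, Fintype.sum_prod_type, trace, mul_apply,
    Complex.mul_conj, Complex.normSq_eq_norm_sq, -Complex.ofReal_pow]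

lemma expect_conj_eq_norm_hsVec_sq (Ω Y b : Matrix n n ℂ) :
    expect (Ωᴴ * Ω) (Y * (b * bᴴ) * Yᴴ) = ‖hsVec (Ω * Y * b)‖ ^ 2 := by
  rw [norm_hsVec_sq, expect_apply, mul_assoc, trace_mul_comm]
  simp only [conjTranspose_mul, mul_assoc]

lemma expect_one [DecidableEq n] (ω : Matrix n n ℂ) : expect ω 1 = ω.trace.re := by
  rw [expect_apply, mul_one]

lemma abs_expect_le_sqrt {ω D : Matrix n n ℂ} (hω : ω.PosSemidef) (h1 : ω.trace = 1)
    (hD : D.IsHermitian) : |expect ω D| ≤ √(expect ω (D * D)) := by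
  classical
  apply Real.abs_le_sqrt
  set c := expect ω D with hc
  have h_nonneg : 0 ≤ expect ω ((D - c • 1) * (D - c • 1)ᴴ) :=
    expect_nonneg hω (posSemidef_self_mul_conjTranspose _)
  have h_expand : (D - c • 1) * (D - c • 1)ᴴ = D * D - (2 * c) • D + (c ^ 2) • 1 := by
    rw [conjTranspose_sub, hD.eq]
    simp only [conjTranspose_smul, star_trivial, conjTranspose_one, sub_mul, mul_sub,
      smul_mul_assoc, mul_smul_comm, one_mul, mul_one]
    module
  rw [h_expand, map_add, map_sub, map_smul, map_smul, ← hc, expect_one, h1, Complex.one_re,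
    smul_eq_mul, smul_eq_mul] at h_nonneg
  linarith

-- Gentle measurement: `T` close to `1` in a weighted `L²` sense hardly disturbs expectations.
lemma abs_expect_conj_sub_le [DecidableEq n] {ω B : Matrix n n ℂ} (hω : ω.PosSemidef)
    (hB : B.PosSemidef) (T : Matrix n n ℂ) :
    |expect ω (T * B * Tᴴ) - expect ω B| ≤
      √(expect ω ((T - 1) * B * (T - 1)ᴴ)) * (√(expect ω (T * B * Tᴴ)) + √(expect ω B)) := by
  obtain ⟨Ω, rfl⟩ := exists_conjTranspose_mul_self hω
  obtain ⟨b, rfl⟩ := exists_self_mul_conjTranspose hB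
  have h_one : expect (Ωᴴ * Ω) (b * bᴴ) = ‖hsVec (Ω * 1 * b)‖ ^ 2 := by
    rw [← expect_conj_eq_norm_hsVec_sq, one_mul, conjTranspose_one, mul_one]
  have h_sub : hsVec (Ω * (T - 1) * b) = hsVec (Ω * T * b) - hsVec (Ω * 1 * b) := by
    rw [← map_sub, mul_sub, sub_mul]
  simp only [h_one, expect_conj_eq_norm_hsVec_sq, h_sub, Real.sqrt_sq (norm_nonneg _)]
  rw [sq_sub_sq, abs_mul, mul_comm, abs_of_nonneg (a := _ + _) (by positivity)]
  gcongr
  exact abs_norm_sub_norm_le _ _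

end Expectation

section Truncation

variable {n : Type*} [Fintype n] [DecidableEq n]

/-- The contraction `(1 + |Δ|)⁻¹`, which cuts `1 + Δ` back below `1` at a cost of order `Δ²`. -/
def truncation (Δ : Matrix n n ℂ) : Matrix n n ℂ := cfc (fun x : ℝ => (1 + |x|)⁻¹) Δ

lemma isHermitian_truncation (Δ : Matrix n n ℂ) : (truncation Δ).IsHermitian :=
  cfc_predicate _ _

lemma cfc_mul_one_add_mul_cfc {Δ : Matrix n n ℂ} (hΔ : Δ.IsHermitian) (f : ℝ → ℝ) :
    cfc f Δ * (1 + Δ) * cfc f Δ = cfc (fun x => f x * (1 + x) * f x) Δ := by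
  have hΔ' : IsSelfAdjoint Δ := hΔ
  have h_cont (g : ℝ → ℝ) : ContinuousOn g (spectrum ℝ Δ) := finite_real_spectrum.continuousOn g
  rw [cfc_mul _ f Δ (h_cont _) (h_cont f), cfc_mul f _ Δ (h_cont f), cfc_const_add .., cfc_id' ..,
    map_one]

lemma truncation_mul_one_add_mul_truncation_le {Δ : Matrix n n ℂ} (hΔ : Δ.IsHermitian) :
    truncation Δ * (1 + Δ) * truncation Δ ≤ 1 := by
  rw [truncation, cfc_mul_one_add_mul_cfc hΔ]
  refine cfc_le_one _ _ fun x _ => ?_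
  calc (1 + |x|)⁻¹ * (1 + x) * (1 + |x|)⁻¹
      ≤ (1 + |x|)⁻¹ * (1 + |x|) * (1 + |x|)⁻¹ := by gcongr; exact le_abs_self x
    _ = (1 + |x|)⁻¹ := by field_simp
    _ ≤ 1 := inv_le_one_of_one_le₀ (by linarith [abs_nonneg x])

lemma truncation_sub_one_mul_one_add_mul_le {Δ : Matrix n n ℂ} (hΔ : Δ.IsHermitian) :
    (truncation Δ - 1) * (1 + Δ) * (truncation Δ - 1) ≤ Δ * Δ := by
  have hΔ' : IsSelfAdjoint Δ := hΔ
  have h_cont (g : ℝ → ℝ) : ContinuousOn g (spectrum ℝ Δ) := finite_real_spectrum.continuousOn g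
  have h_sub_one : truncation Δ - 1 = cfc (fun x : ℝ => (1 + |x|)⁻¹ - 1) Δ := by
    rw [cfc_sub _ _ Δ (h_cont _), cfc_const_one ℝ Δ, truncation]
  have h_sq : Δ * Δ = cfc (fun x : ℝ => x * x) Δ := by
    rw [cfc_mul .., cfc_id' ..]
  rw [h_sub_one, cfc_mul_one_add_mul_cfc hΔ, h_sq]
  refine cfc_mono (fun x _ => ?_) (h_cont _)
  have h_sub : (1 + |x|)⁻¹ - 1 = -(|x| / (1 + |x|)) := by field_simp; ring
  calc ((1 + |x|)⁻¹ - 1) * (1 + x) * ((1 + |x|)⁻¹ - 1)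
      = (|x| / (1 + |x|)) ^ 2 * (1 + x) := by rw [h_sub]; ring
    _ ≤ (|x| / (1 + |x|)) ^ 2 * (1 + |x|) := by gcongr; exact le_abs_self x
    _ = |x| ^ 2 / (1 + |x|) := by field_simp
    _ ≤ |x| ^ 2 := div_le_self (by positivity) (by linarith [abs_nonneg x])
    _ = x * x := by rw [sq_abs, sq]

end Truncation

section Empirical

lemma exists_le_sum_mul {W : Type*} [Fintype W] {p : W → ℝ} (hp : ∀ v, 0 ≤ p v)
    (hp1 : ∑ v, p v = 1) (f : W → ℝ) : ∃ v, f v ≤ ∑ u, p u * f u := by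
  by_contra! h
  obtain ⟨v, hv⟩ : ∃ v, 0 < p v := by
    by_contra! h0
    linarith [Finset.sum_nonpos fun v (_ : v ∈ Finset.univ) => h0 v]
  have h_lt : ∑ v, p v * ∑ u, p u * f u < ∑ v, p v * f v :=
    Finset.sum_lt_sum (fun v _ => mul_le_mul_of_nonneg_left (h v).le (hp v))
      ⟨v, Finset.mem_univ v, mul_lt_mul_of_pos_left (h v) hv⟩
  rw [← Finset.sum_mul, hp1, one_mul] at h_lt
  exact h_lt.false

open scoped RealInnerProductSpace

variable {E W : Type*} [NormedAddCommGroup E] [InnerProductSpace ℝ E] [Fintype W]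

lemma sum_mul_norm_add_sub_mean_sq_le {p : W → ℝ} (hp1 : ∑ v, p v = 1) (x : W → E) (y : E) :
    ∑ v, p v * ‖y + (x v - ∑ u, p u • x u)‖ ^ 2 ≤ ‖y‖ ^ 2 + ∑ v, p v * ‖x v‖ ^ 2 := by
  set c := ∑ u, p u • x u with hc
  have h_expand (v : W) : p v * ‖y + (x v - c)‖ ^ 2
      = p v * ‖y - c‖ ^ 2 + 2 * ⟪y - c, p v • x v⟫ + p v * ‖x v‖ ^ 2 := by
    rw [add_sub_left_comm, add_comm, norm_add_sq_real, inner_smul_right]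
    ring
  have h_sq : ‖y‖ ^ 2 = ‖y - c‖ ^ 2 + 2 * ⟪y - c, c⟫ + ‖c‖ ^ 2 := by
    rw [← norm_add_sq_real, sub_add_cancel]
  simp only [h_expand, Finset.sum_add_distrib, ← Finset.mul_sum, ← Finset.sum_mul, ← inner_sum,
    ← hc, hp1, one_mul, h_sq]
  linarith [sq_nonneg ‖c‖]

lemma exists_norm_sum_sub_mean_sq_le {p : W → ℝ} (hp : ∀ v, 0 ≤ p v) (hp1 : ∑ v, p v = 1)
    (x : W → E) (M : ℕ) :
    ∃ w : Fin M → W, ‖∑ μ, (x (w μ) - ∑ v, p v • x v)‖ ^ 2 ≤ M * ∑ v, p v * ‖x v‖ ^ 2 := by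
  induction M with
  | zero => exact ⟨Fin.elim0, by simp⟩
  | succ M ih =>
    obtain ⟨w, hw⟩ := ih
    obtain ⟨v, hv⟩ := exists_le_sum_mul hp hp1 fun v =>
      ‖∑ μ, (x (w μ) - ∑ u, p u • x u) + (x v - ∑ u, p u • x u)‖ ^ 2
    refine ⟨Fin.snoc w v, ?_⟩
    simp only [Fin.sum_univ_castSucc, Fin.snoc_castSucc, Fin.snoc_last]
    push_cast
    linarith [sum_mul_norm_add_sub_mean_sq_le hp1 x (∑ μ, (x (w μ) - ∑ u, p u • x u))]

end Empirical

section Tensor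

variable {l d : ℕ}

lemma tensor_mul (F G : Fin l → Matrix (Fin d) (Fin d) ℂ) :
    tensor F * tensor G = tensor fun i => F i * G i := by
  ext x y
  simp only [tensor, mul_apply, of_apply, ← Finset.prod_mul_distrib, Fintype.prod_sum]

lemma conjTranspose_tensor (F : Fin l → Matrix (Fin d) (Fin d) ℂ) :
    (tensor F)ᴴ = tensor fun i => (F i)ᴴ := by
  ext x y
  simp [tensor]

lemma tensor_diagonal (f : Fin l → Fin d → ℂ) :
    tensor (fun i => diagonal (f i)) = diagonal fun x => ∏ i, f i (x i) := by
  ext x y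
  simp only [tensor, of_apply, diagonal_apply]
  split_ifs with h
  · simp only [h, if_true]
  · obtain ⟨i, hi⟩ := Function.ne_iff.1 h
    exact Finset.prod_eq_zero (Finset.mem_univ i) (if_neg hi)

lemma tensor_one : tensor (fun _ : Fin l => (1 : Matrix (Fin d) (Fin d) ℂ)) = 1 := by
  simpa using tensor_diagonal (l := l) (d := d) fun _ _ => 1

lemma trace_tensor (F : Fin l → Matrix (Fin d) (Fin d) ℂ) :
    (tensor F).trace = ∏ i, (F i).trace := by
  simp only [tensor, trace, diag, of_apply, Fintype.prod_sum]

lemma tensor_smul (c : Fin l → ℝ) (F : Fin l → Matrix (Fin d) (Fin d) ℂ) :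
    tensor (fun i => c i • F i) = (∏ i, c i) • tensor F := by
  ext x y
  simp [tensor, Finset.prod_mul_distrib]

lemma sum_tensor {γ : Type*} [Fintype γ] (F : Fin l → γ → Matrix (Fin d) (Fin d) ℂ) :
    ∑ J : Fin l → γ, tensor (fun i => F i (J i)) = tensor fun i => ∑ c, F i c := by
  ext x y
  simp only [tensor, of_apply, Matrix.sum_apply, Fintype.prod_sum]

lemma posSemidef_tensor {F : Fin l → Matrix (Fin d) (Fin d) ℂ} (h : ∀ i, (F i).PosSemidef) :
    (tensor F).PosSemidef := by
  choose B hB using fun i => exists_conjTranspose_mul_self (h i)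
  rw [funext hB, ← tensor_mul, ← conjTranspose_tensor]
  exact posSemidef_conjTranspose_mul_self _

lemma tensor_mono {F G : Fin l → Matrix (Fin d) (Fin d) ℂ} (hF : ∀ i, (F i).PosSemidef)
    (h : ∀ i, F i ≤ G i) : tensor F ≤ tensor G := by
  set T : (Fin l → Bool) → Matrix (Fin l → Fin d) (Fin l → Fin d) ℂ :=
    fun J => tensor fun i => bif J i then F i else G i - F i
  have h_nonneg (J : Fin l → Bool) : 0 ≤ T J := by
    refine (posSemidef_tensor fun i => ?_).nonneg
    cases J i
    exacts [le_iff.1 (h i), hF i]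
  calc tensor F = T fun _ => true := rfl
    _ ≤ ∑ J, T J := Finset.single_le_sum (fun J _ => h_nonneg J) (Finset.mem_univ _)
    _ = tensor G := by simp [T, sum_tensor (fun i b => bif b then F i else G i - F i)]

/-- The operator `ρ^{⊗ [l] ∖ k} ⊗ F_k`. -/
abbrev tensorWith (ρ : Matrix (Fin d) (Fin d) ℂ) (k : Fin l) (F : Matrix (Fin d) (Fin d) ℂ) :
    Matrix (Fin l → Fin d) (Fin l → Fin d) ℂ :=
  tensor (Function.update (fun _ => ρ) k F)

lemma posSemidef_update {ρ F : Matrix (Fin d) (Fin d) ℂ} (hρ : ρ.PosSemidef) (hF : F.PosSemidef)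
    (k i : Fin l) : (Function.update (fun _ => ρ) k F i).PosSemidef := by
  obtain rfl | hi := eq_or_ne i k
  · rwa [Function.update_self]
  · rwa [Function.update_of_ne hi]

lemma posSemidef_tensorWith {ρ F : Matrix (Fin d) (Fin d) ℂ} (hρ : ρ.PosSemidef)
    (hF : F.PosSemidef) (k : Fin l) : (tensorWith ρ k F).PosSemidef :=
  posSemidef_tensor (posSemidef_update hρ hF k)

lemma tensorWith_mono {ρ F G : Matrix (Fin d) (Fin d) ℂ} (hρ : ρ.PosSemidef) (hF : F.PosSemidef)
    (h : F ≤ G) (k : Fin l) : tensorWith ρ k F ≤ tensorWith ρ k G := by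
  refine tensor_mono (posSemidef_update hρ hF k) fun i => ?_
  obtain rfl | hi := eq_or_ne i k
  · rwa [Function.update_self, Function.update_self]
  · rw [Function.update_of_ne hi, Function.update_of_ne hi]

lemma trace_tensorWith {ρ F : Matrix (Fin d) (Fin d) ℂ} (hρ : ρ.trace = 1) (k : Fin l) :
    (tensorWith ρ k F).trace = F.trace := by
  rw [trace_tensor, Fintype.prod_eq_single k fun i hi => by rw [Function.update_of_ne hi, hρ],
    Function.update_self]

lemma tensorWith_mul_tensorWith (ρ ρ' F F' : Matrix (Fin d) (Fin d) ℂ) (k : Fin l) :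
    tensorWith ρ k F * tensorWith ρ' k F' = tensorWith (ρ * ρ') k (F * F') := by
  rw [tensor_mul]
  congr with i : 1
  obtain rfl | hi := eq_or_ne i k
  · simp only [Function.update_self]
  · simp only [Function.update_of_ne hi]

lemma pow_smul_tensorWith_le {ρ ρ' F : Matrix (Fin d) (Fin d) ℂ} (hρ : ρ.PosSemidef)
    (hF : F.PosSemidef) {c : ℝ} (hc0 : 0 ≤ c) (hc1 : c ≤ 1) (h : c • ρ ≤ ρ') (k : Fin l) :
    c ^ l • tensorWith ρ k F ≤ tensorWith ρ' k F := by
  have h_pow : c ^ l • tensorWith ρ k F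
      = tensor fun i => c • Function.update (fun _ => ρ) k F i := by
    rw [tensor_smul, Finset.prod_const, Finset.card_univ, Fintype.card_fin]
  rw [h_pow]
  refine tensor_mono (fun i => (posSemidef_update hρ hF k i).smul hc0) fun i => ?_
  obtain rfl | hi := eq_or_ne i k
  · simpa only [Function.update_self, one_smul] using smul_le_smul_of_nonneg_right hc1 hF.nonneg
  · simpa only [Function.update_of_ne hi] using h

lemma sum_tensor_of_apply_eq {γ : Type*} [Fintype γ] [DecidableEq γ]
    (F : γ → Matrix (Fin d) (Fin d) ℂ) (k : Fin l) (j : γ) :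
    ∑ J : Fin l → γ with J k = j, tensor (fun i => F (J i)) = tensorWith (∑ c, F c) k (F j) := by
  have h_update : Function.update (fun _ => ∑ c, F c) k (F j)
      = fun i => ∑ c, if i = k → c = j then F c else 0 := by
    ext1 i
    obtain rfl | hi := eq_or_ne i k
    · simp
    · simp [hi]
  rw [tensorWith, h_update, ← sum_tensor, Finset.sum_filter]
  refine Finset.sum_congr rfl fun J _ => ?_
  split_ifs with hJ
  · congr with i : 1
    rw [if_pos]
    rintro rfl
    exact hJ
  · ext x y
    exact (Finset.prod_eq_zero (Finset.mem_univ k) (by simp [hJ])).symm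

lemma tensorWith_apply (ρ F : Matrix (Fin d) (Fin d) ℂ) (k : Fin l) (x y : Fin l → Fin d) :
    tensorWith ρ k F x y = F (x k) (y k) * ∏ i : {i // i ≠ k}, ρ (x i) (y i) := by
  rw [tensorWith, tensor, of_apply, Fintype.prod_eq_mul_prod_subtype_ne _ k, Function.update_self]
  congr with i
  rw [Function.update_of_ne i.2]

lemma trace_partialTraceExcept_mul (k : Fin l) (X : Matrix (Fin l → Fin d) (Fin l → Fin d) ℂ)
    (B : Matrix (Fin d) (Fin d) ℂ) :
    (partialTraceExcept k X * B).trace = (X * tensorWith 1 k B).trace := by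
  set e := (Equiv.funSplitAt k (Fin d)).symm with he
  have h_entry (s t : Fin d) (w z : {i : Fin l // i ≠ k} → Fin d) :
      tensorWith 1 k B (e (t, w)) (e (s, z)) = if w = z then B t s else 0 := by
    rw [tensorWith_apply]
    have h_ne (i : {i // i ≠ k}) : (i : Fin l) ≠ k := i.2
    simp [he, h_ne, one_apply, Finset.prod_ite_zero, funext_iff]
  rw [trace, trace, ← Equiv.sum_comp e, Fintype.sum_prod_type]
  refine Finset.sum_congr rfl fun s _ => ?_
  simp only [diag_apply, mul_apply, partialTraceExcept, of_apply, Finset.sum_mul,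
    ← Equiv.sum_comp e fun x => X _ x * _, Fintype.sum_prod_type, h_entry, mul_ite, mul_zero,
    Finset.sum_ite_eq', Finset.mem_univ, if_true]
  exact Finset.sum_comm

lemma trace_partialTraceExcept_tensorWith_mul (ρ B : Matrix (Fin d) (Fin d) ℂ) (k : Fin l)
    (Y : Matrix (Fin l → Fin d) (Fin l → Fin d) ℂ) :
    (partialTraceExcept k (tensorWith ρ k 1 * Y) * B).trace = (tensorWith ρ k B * Y).trace := by
  rw [trace_partialTraceExcept_mul, trace_mul_comm, ← mul_assoc, tensorWith_mul_tensorWith,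
    one_mul, mul_one]

end Tensor

section OpNorm

variable {n : Type} [Fintype n] [DecidableEq n]

open scoped Matrix.Norms.L2Operator in
lemma opNorm_le_of_isHermitian {D : Matrix n n ℂ} (hD : D.IsHermitian) {δ : ℝ} (hδ : 0 ≤ δ)
    (h : ∀ v : n → ℂ, star v ⬝ᵥ v = 1 → |(star v ⬝ᵥ D *ᵥ v).re| ≤ δ) : opNorm D ≤ δ := by
  have h_eigenvalues (i : n) : |hD.eigenvalues i| ≤ δ := by
    rw [hD.eigenvalues_eq]
    refine h _ ?_
    rw [dotProduct_comm, ← EuclideanSpace.inner_eq_star_dotProduct, inner_self_eq_norm_sq_to_K,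
      hD.eigenvectorBasis.orthonormal.1 i]
    norm_num
  have h_norm : opNorm D = ‖D‖ := (Matrix.l2_opNorm_def D).symm
  rw [h_norm, hD.spectral_theorem, Unitary.conjStarAlgAut_apply,
    ← Unitary.coe_star, CStarRing.norm_mul_coe_unitary, CStarRing.norm_coe_unitary_mul,
    Matrix.l2_opNorm_diagonal, pi_norm_le_iff_of_nonneg hδ]
  intro i
  simpa using h_eigenvalues i

lemma isHermitian_of_forall_im_dotProduct_eq_zero {n : Type*} [Fintype n] {D : Matrix n n ℂ}
    (h : ∀ v : n → ℂ, (star v ⬝ᵥ D *ᵥ v).im = 0) : D.IsHermitian := by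
  classical
  rw [← Matrix.isSymmetric_toEuclideanLin_iff, LinearMap.isSymmetric_iff_inner_map_self_real]
  intro v
  have h_inner : inner ℂ v (toEuclideanLin D v)
      = star (WithLp.ofLp v) ⬝ᵥ D *ᵥ WithLp.ofLp v := by
    rw [EuclideanSpace.inner_eq_star_dotProduct, dotProduct_comm]
    rfl
  rw [inner_conj_symm, h_inner, ← inner_conj_symm, h_inner]
  exact (Complex.conj_eq_iff_im.2 (h _)).symm

end OpNorm

section Chebyshev

variable {ι γ : Type*} [Fintype ι] [DecidableEq ι]

/-- The probability of the word `x` when its letters are independent, the `k`-th with distribution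
`g` and all others with distribution `q`. -/
def wordProb (q : γ → ℝ) (k : ι) (g : γ → ℝ) (x : ι → γ) : ℝ :=
  ∏ i, Function.update (fun _ => q) k g i (x i)

lemma wordProb_nonneg {q g : γ → ℝ} (hq : 0 ≤ q) (hg : 0 ≤ g) (k : ι) (x : ι → γ) :
    0 ≤ wordProb q k g x := by
  refine Finset.prod_nonneg fun i _ => ?_
  rcases eq_or_ne i k with rfl | hi
  · simpa using hg _
  · simpa [hi] using hq _

variable [Fintype γ]

lemma sum_prod_mul_apply_mul_apply (p f : ι → γ → ℝ) (h1 : ∀ i, ∑ a, p i a = 1)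
    (h0 : ∀ i, ∑ a, p i a * f i a = 0) (i j : ι) :
    ∑ x : ι → γ, (∏ t, p t (x t)) * (f i (x i) * f j (x j))
      = if i = j then ∑ a, p i a * f i a ^ 2 else 0 := by
  have h_factor : ∑ x : ι → γ, (∏ t, p t (x t)) * (f i (x i) * f j (x j))
      = ∏ t, ∑ a, p t a * ((if t = i then f t a else 1) * (if t = j then f t a else 1)) := by
    simp only [Fintype.prod_sum, Finset.prod_mul_distrib, Finset.prod_ite_eq', Finset.mem_univ,
      if_true]
  rw [h_factor]
  split_ifs with hij
  · subst hij
    rw [Fintype.prod_eq_single i fun t ht => by simp [ht, h1]]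
    simp [sq]
  · exact Finset.prod_eq_zero (Finset.mem_univ i) (by simp [hij, h0])

lemma sum_prod_mul_sum_sq (p f : ι → γ → ℝ) (h1 : ∀ i, ∑ a, p i a = 1)
    (h0 : ∀ i, ∑ a, p i a * f i a = 0) :
    ∑ x : ι → γ, (∏ i, p i (x i)) * (∑ i, f i (x i)) ^ 2 = ∑ i, ∑ a, p i a * f i a ^ 2 := by
  simp only [sq (∑ i, f i _), Finset.sum_mul_sum]
  simp only [Finset.mul_sum]
  rw [Finset.sum_comm]
  refine Finset.sum_congr rfl fun i _ => ?_
  rw [Finset.sum_comm]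
  simp [sum_prod_mul_apply_mul_apply p f h1 h0]

lemma sum_mul_sub_mean_sq_le (q Z : γ → ℝ) (hq1 : ∑ a, q a = 1) :
    ∑ a, q a * (Z a - ∑ b, q b * Z b) ^ 2 ≤ ∑ a, q a * Z a ^ 2 := by
  set μ := ∑ b, q b * Z b with hμ
  have h_expand (a : γ) :
      q a * (Z a - μ) ^ 2 = q a * Z a ^ 2 - 2 * μ * (q a * Z a) + μ ^ 2 * q a := by ring
  simp only [h_expand, Finset.sum_add_distrib, Finset.sum_sub_distrib, ← Finset.mul_sum, hq1,
    ← hμ]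
  linarith [sq_nonneg μ]

lemma mul_sum_le_sum_mul_sq {w g : γ → ℝ} (hw : ∀ x, 0 ≤ w x) {θ : ℝ} (hθ : 0 ≤ θ)
    (S : Finset γ) (hS : ∀ x ∈ S, θ ≤ |g x|) :
    θ ^ 2 * ∑ x ∈ S, w x ≤ ∑ x, w x * g x ^ 2 := by
  rw [Finset.mul_sum]
  refine (Finset.sum_le_sum fun x hx => ?_).trans (Finset.sum_le_sum_of_subset_of_nonneg
    (Finset.subset_univ S) fun x _ _ => mul_nonneg (hw x) (sq_nonneg _))
  rw [mul_comm, ← sq_abs (g x)]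
  exact mul_le_mul_of_nonneg_left (pow_le_pow_left₀ hθ (hS x hx) 2) (hw x)

lemma sum_wordProb_mul_sum_erase_sq_le {q g : γ → ℝ} (hq1 : ∑ a, q a = 1) (hg1 : ∑ a, g a = 1)
    (hq : 0 ≤ q) (k : ι) (Z : γ → ℝ) :
    ∑ x, wordProb q k g x * (∑ i ∈ Finset.univ.erase k, (Z (x i) - ∑ a, q a * Z a)) ^ 2
      ≤ Fintype.card ι * ∑ a, q a * Z a ^ 2 := by
  set μ := ∑ a, q a * Z a with hμ
  set f : ι → γ → ℝ := Function.update (fun _ a => Z a - μ) k 0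
  have h_sum (x : ι → γ) : ∑ i ∈ Finset.univ.erase k, (Z (x i) - μ) = ∑ i, f i (x i) := by
    rw [← Finset.add_sum_erase _ _ (Finset.mem_univ k)]
    simp only [f, Function.update_self, Pi.zero_apply, zero_add]
    exact Finset.sum_congr rfl fun i hi => by
      rw [Function.update_of_ne (Finset.ne_of_mem_erase hi)]
  have h_one (i : ι) : ∑ a, Function.update (fun _ => q) k g i a = 1 := by
    rcases eq_or_ne i k with rfl | hi
    · simpa using hg1
    · simpa [hi] using hq1
  have h_zero (i : ι) : ∑ a, Function.update (fun _ => q) k g i a * f i a = 0 := by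
    rcases eq_or_ne i k with rfl | hi
    · simp [f]
    · simp [f, hi, mul_sub, ← Finset.sum_mul, hq1, hμ]
  have h_var (i : ι) :
      ∑ a, Function.update (fun _ => q) k g i a * f i a ^ 2 ≤ ∑ a, q a * Z a ^ 2 := by
    rcases eq_or_ne i k with rfl | hi
    · simpa [f] using Finset.sum_nonneg fun a _ => mul_nonneg (hq a) (sq_nonneg (Z a))
    · simpa [f, hi] using sum_mul_sub_mean_sq_le q Z hq1
  calc _ = ∑ i, ∑ a, Function.update (fun _ => q) k g i a * f i a ^ 2 := by
        simp only [h_sum, wordProb]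
        exact sum_prod_mul_sum_sq _ f h_one h_zero
    _ ≤ ∑ _ : ι, ∑ a, q a * Z a ^ 2 := Finset.sum_le_sum fun i _ => h_var i
    _ = _ := by rw [Finset.sum_const, Finset.card_univ, nsmul_eq_mul]

lemma sum_wordProb_le_div_sq {q g : γ → ℝ} (hq : 0 ≤ q) (hg : 0 ≤ g) (hq1 : ∑ a, q a = 1)
    (hg1 : ∑ a, g a = 1) (k : ι) (Z : γ → ℝ) {V θ : ℝ} (hθ : 0 < θ)
    (hV : ∑ a, q a * Z a ^ 2 ≤ V) (S : Finset (ι → γ))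
    (hS : ∀ x ∈ S,
      θ * √(Fintype.card ι) ≤ |∑ i ∈ Finset.univ.erase k, (Z (x i) - ∑ a, q a * Z a)|) :
    ∑ x ∈ S, wordProb q k g x ≤ V / θ ^ 2 := by
  have h_card : 0 < (Fintype.card ι : ℝ) := by exact_mod_cast Fintype.card_pos_iff.2 ⟨k⟩
  have h := calc
    (θ * √(Fintype.card ι)) ^ 2 * ∑ x ∈ S, wordProb q k g x
      ≤ Fintype.card ι * ∑ a, q a * Z a ^ 2 :=
        (mul_sum_le_sum_mul_sq (wordProb_nonneg hq hg k) (by positivity) S hS).trans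
          (sum_wordProb_mul_sum_erase_sq_le hq1 hg1 hq k Z)
    _ ≤ Fintype.card ι * V := by gcongr
  rw [mul_pow, Real.sq_sqrt h_card.le, mul_comm (θ ^ 2), mul_assoc] at h
  rw [le_div_iff₀' (by positivity)]
  exact le_of_mul_le_mul_left h h_card

end Chebyshev

section Entropy

lemma negMulLog_add_le {x y : ℝ} (hx : 0 ≤ x) (hy : 0 ≤ y) :
    Real.negMulLog (x + y) ≤ Real.negMulLog x + Real.negMulLog y := by
  rcases hx.eq_or_lt with rfl | hx
  · simp
  rcases hy.eq_or_lt with rfl | hy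
  · simp
  have h₁ : x * Real.log x ≤ x * Real.log (x + y) := by gcongr; linarith
  have h₂ : y * Real.log y ≤ y * Real.log (x + y) := by gcongr; linarith
  simp only [Real.negMulLog]
  linarith

variable {n : Type} [Fintype n] [DecidableEq n]

lemma re_trace_cfc {A : Matrix n n ℂ} (hA : A.IsHermitian) (f : ℝ → ℝ) :
    (cfc f A).trace.re = ∑ i, f (hA.eigenvalues i) := by
  rw [hA.cfc_eq, IsHermitian.cfc, Unitary.conjStarAlgAut_apply, trace_mul_cycle,
    Unitary.coe_star_mul_self, one_mul, trace_diagonal]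
  simp

lemma re_trace_eq_sum_eigenvalues {A : Matrix n n ℂ} (hA : A.IsHermitian) :
    A.trace.re = ∑ i, hA.eigenvalues i := by
  rw [hA.trace_eq_sum_eigenvalues, Complex.re_sum]
  rfl

lemma eigenvalues_le_re_trace {A : Matrix n n ℂ} (hA : A.PosSemidef) (i : n) :
    hA.1.eigenvalues i ≤ A.trace.re := by
  rw [re_trace_eq_sum_eigenvalues hA.1]
  exact Finset.single_le_sum (f := hA.1.eigenvalues) (fun i _ => hA.eigenvalues_nonneg i)
    (Finset.mem_univ i)

lemma entropy_eq_sum {A : Matrix n n ℂ} (hA : A.IsHermitian) :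
    entropy A = ∑ i, Real.negMulLog (hA.eigenvalues i) :=
  re_trace_cfc hA _

lemma entropy_cfc {A : Matrix n n ℂ} (hA : A.IsHermitian) (f : ℝ → ℝ) :
    entropy (cfc f A) = ∑ i, Real.negMulLog (f (hA.eigenvalues i)) := by
  have hA' : IsSelfAdjoint A := hA
  rw [entropy, ← cfc_comp' Real.negMulLog f A (finite_real_spectrum.image f |>.continuousOn _)
    (finite_real_spectrum.continuousOn f), re_trace_cfc hA]

lemma entropy_smul {A : Matrix n n ℂ} (hA : A.IsHermitian) (c : ℝ) :
    entropy (c • A) = c * entropy A + A.trace.re * Real.negMulLog c := by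
  have hA' : IsSelfAdjoint A := hA
  rw [← cfc_const_mul_id c A, entropy_cfc hA, entropy_eq_sum hA, re_trace_eq_sum_eigenvalues hA]
  simp only [Real.negMulLog_mul, Finset.sum_add_distrib, Finset.mul_sum, Finset.sum_mul]
  rw [add_comm]

lemma entropy_eq_of_charpoly_eq {A B : Matrix n n ℂ} (hA : A.IsHermitian) (hB : B.IsHermitian)
    (h : A.charpoly = B.charpoly) : entropy A = entropy B := by
  have h_roots {C : Matrix n n ℂ} (hC : C.IsHermitian) :
      entropy C = (C.charpoly.roots.map fun z => Real.negMulLog z.re).sum := by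
    rw [entropy_eq_sum hC, hC.roots_charpoly_eq_eigenvalues, Multiset.map_map]
    rfl
  rw [h_roots hA, h_roots hB, h]

lemma entropy_nonneg {A : Matrix n n ℂ} (hA : A.PosSemidef) (h1 : A.trace.re ≤ 1) :
    0 ≤ entropy A := by
  rw [entropy_eq_sum hA.1]
  exact Finset.sum_nonneg fun i _ =>
    Real.negMulLog_nonneg (hA.eigenvalues_nonneg i) ((eigenvalues_le_re_trace hA i).trans h1)

lemma entropy_le_card {A : Matrix n n ℂ} (hA : A.PosSemidef) :
    entropy A ≤ Fintype.card n := by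
  rw [entropy_eq_sum hA.1, Fintype.card_eq_sum_ones, Nat.cast_sum, Nat.cast_one]
  refine Finset.sum_le_sum fun i _ => ?_
  have h_nonneg := hA.eigenvalues_nonneg i
  linarith [Real.negMulLog_le_one_sub_self h_nonneg]

lemma exists_diagonalization {A : Matrix n n ℂ} (hA : A.IsHermitian) :
    ∃ U : Matrix n n ℂ, Uᴴ * U = 1 ∧ U * Uᴴ = 1 ∧
      Uᴴ * A * U = diagonal fun i => (hA.eigenvalues i : ℂ) := by
  refine ⟨hA.eigenvectorUnitary, Unitary.coe_star_mul_self hA.eigenvectorUnitary,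
    Unitary.coe_mul_star_self hA.eigenvectorUnitary, ?_⟩
  have h := hA.conjStarAlgAut_star_eigenvectorUnitary
  rwa [Unitary.conjStarAlgAut_star_apply] at h

lemma re_mul_diagonal_mul_conjTranspose_apply (W : Matrix n n ℂ) (x : n → ℝ) (i : n) :
    ((W * diagonal (fun k => (x k : ℂ)) * Wᴴ) i i).re = ∑ k, ‖W i k‖ ^ 2 * x k := by
  rw [mul_apply, Complex.re_sum]
  refine Finset.sum_congr rfl fun k _ => ?_
  rw [mul_diagonal, conjTranspose_apply, mul_right_comm, RCLike.star_def, Complex.mul_conj,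
    Complex.normSq_eq_norm_sq, ← Complex.ofReal_mul, Complex.ofReal_re]

lemma sum_norm_sq_row_eq_one {W : Matrix n n ℂ} (hW : W * Wᴴ = 1) (i : n) :
    ∑ k, ‖W i k‖ ^ 2 = 1 := by
  have h := re_mul_diagonal_mul_conjTranspose_apply W 1 i
  simpa [hW] using h.symm

-- Peierls' inequality.
lemma entropy_le_sum_negMulLog_diag {A : Matrix n n ℂ} (hA : A.PosSemidef) {U : Matrix n n ℂ}
    (hU : Uᴴ * U = 1) :
    entropy A ≤ ∑ i, Real.negMulLog ((Uᴴ * A * U) i i).re := by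
  obtain ⟨V, -, hV', h_diag⟩ := exists_diagonalization hA.1
  have h_nonneg := hA.eigenvalues_nonneg
  rw [entropy_eq_sum hA.1]
  set x := hA.1.eigenvalues
  set W := Uᴴ * V with hW_def
  have hW : W * Wᴴ = 1 := by
    rw [hW_def, conjTranspose_mul, conjTranspose_conjTranspose, mul_assoc, ← mul_assoc V, hV',
      one_mul, hU]
  have hW' : Wᴴ * Wᴴᴴ = 1 := by rw [conjTranspose_conjTranspose, mul_eq_one_comm.1 hW]
  have h_apply (i : n) : ((Uᴴ * A * U) i i).re = ∑ k, ‖W i k‖ ^ 2 * x k := by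
    have h_conj : Uᴴ * A * U = W * (Vᴴ * A * V) * Wᴴ := by
      calc Uᴴ * A * U = Uᴴ * (V * Vᴴ) * A * (V * Vᴴ) * U := by rw [hV', mul_one, mul_one]
        _ = W * (Vᴴ * A * V) * Wᴴ := by
          simp only [hW_def, conjTranspose_mul, conjTranspose_conjTranspose, mul_assoc]
    rw [h_conj, h_diag, re_mul_diagonal_mul_conjTranspose_apply]
  calc ∑ k, Real.negMulLog (x k) = ∑ k, (∑ i, ‖W i k‖ ^ 2) * Real.negMulLog (x k) := by
        refine Finset.sum_congr rfl fun k _ => ?_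
        simpa using congrArg (· * Real.negMulLog (x k)) (sum_norm_sq_row_eq_one hW' k).symm
    _ = ∑ i, ∑ k, ‖W i k‖ ^ 2 * Real.negMulLog (x k) := by
        simp only [Finset.sum_mul]
        rw [Finset.sum_comm]
    _ ≤ ∑ i, Real.negMulLog ((Uᴴ * A * U) i i).re := by
        refine Finset.sum_le_sum fun i _ => ?_
        rw [h_apply]
        exact Real.concaveOn_negMulLog.le_map_sum (t := Finset.univ) (w := fun k => ‖W i k‖ ^ 2)
          (p := x) (fun k _ => by positivity) (sum_norm_sq_row_eq_one hW i) fun k _ => h_nonneg k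

lemma sum_mul_entropy_le {ι : Type*} [Fintype ι] {w : ι → ℝ} (hw : ∀ j, 0 ≤ w j)
    (hw1 : ∑ j, w j = 1) {A : ι → Matrix n n ℂ} (hA : ∀ j, (A j).PosSemidef) :
    ∑ j, w j * entropy (A j) ≤ entropy (∑ j, w j • A j) := by
  have hS : (∑ j, w j • A j).PosSemidef := posSemidef_sum _ fun j _ => (hA j).smul (hw j)
  obtain ⟨U, hU, -, h_diag⟩ := exists_diagonalization hS.1
  have h_eigenvalues (i : n) :
      hS.1.eigenvalues i = ∑ j, w j * ((Uᴴ * A j * U) i i).re := by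
    have h := congrArg Complex.re (congrFun (congrFun h_diag i) i)
    rw [diagonal_apply_eq, Complex.ofReal_re] at h
    simp [← h, Matrix.mul_sum, Matrix.sum_mul, Matrix.sum_apply]
  calc ∑ j, w j * entropy (A j) ≤ ∑ j, w j * ∑ i, Real.negMulLog ((Uᴴ * A j * U) i i).re :=
        Finset.sum_le_sum fun j _ =>
          mul_le_mul_of_nonneg_left (entropy_le_sum_negMulLog_diag (hA j) hU) (hw j)
    _ = ∑ i, ∑ j, w j * Real.negMulLog ((Uᴴ * A j * U) i i).re := by
        simp only [Finset.mul_sum]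
        rw [Finset.sum_comm]
    _ ≤ ∑ i, Real.negMulLog (hS.1.eigenvalues i) := by
        refine Finset.sum_le_sum fun i _ => ?_
        rw [h_eigenvalues]
        exact Real.concaveOn_negMulLog.le_map_sum (fun j _ => hw j) hw1 fun j _ =>
          (Complex.le_def.1 ((hA j).conjTranspose_mul_mul_same U).diag_nonneg).1
    _ = entropy (∑ j, w j • A j) := (entropy_eq_sum hS.1).symm

end Entropy

section HomEntropy

variable {n : Type} [Fintype n]

lemma re_trace_nonneg {X : Matrix n n ℂ} (hX : X.PosSemidef) : 0 ≤ X.trace.re :=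
  (Complex.le_def.1 hX.trace_nonneg).1

lemma eq_zero_of_re_trace_eq_zero {X : Matrix n n ℂ} (hX : X.PosSemidef) (h : X.trace.re = 0) :
    X = 0 :=
  hX.trace_eq_zero_iff.1 (Complex.ext h (Complex.le_def.1 hX.trace_nonneg).2.symm)

lemma posSemidef_inv_re_trace_smul {X : Matrix n n ℂ} (hX : X.PosSemidef) :
    (X.trace.re⁻¹ • X).PosSemidef :=
  hX.smul (inv_nonneg.2 (re_trace_nonneg hX))

variable [DecidableEq n]

/-- The degree-one homogeneous extension `Tr X · H(X / Tr X)` of the entropy to positive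
semidefinite matrices; it vanishes at `X = 0`. -/
def homEntropy (X : Matrix n n ℂ) : ℝ := X.trace.re * entropy (X.trace.re⁻¹ • X)

lemma homEntropy_of_trace_eq_one {X : Matrix n n ℂ} (hX : X.trace = 1) :
    homEntropy X = entropy X := by
  simp [homEntropy, hX]

lemma homEntropy_smul (c : ℝ) (X : Matrix n n ℂ) : homEntropy (c • X) = c * homEntropy X := by
  rcases eq_or_ne c 0 with rfl | hc
  · simp [homEntropy]
  · have h_trace : (c • X).trace.re = c * X.trace.re := by
      rw [trace_smul, Complex.real_smul, Complex.re_ofReal_mul]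
    rw [homEntropy, homEntropy, h_trace, smul_smul, _root_.mul_inv_rev, mul_assoc _ c⁻¹,
      inv_mul_cancel₀ hc, mul_one, mul_assoc]

lemma homEntropy_nonneg {X : Matrix n n ℂ} (hX : X.PosSemidef) : 0 ≤ homEntropy X := by
  refine mul_nonneg (re_trace_nonneg hX) (entropy_nonneg (posSemidef_inv_re_trace_smul hX) ?_)
  rw [trace_smul, Complex.real_smul, Complex.re_ofReal_mul]
  exact inv_mul_le_one

lemma homEntropy_le_card_mul_trace {X : Matrix n n ℂ} (hX : X.PosSemidef) :
    homEntropy X ≤ Fintype.card n * X.trace.re := by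
  rw [homEntropy, mul_comm]
  exact mul_le_mul_of_nonneg_right (entropy_le_card (posSemidef_inv_re_trace_smul hX))
    (re_trace_nonneg hX)

lemma homEntropy_mul_conjTranspose_comm (A : Matrix n n ℂ) :
    homEntropy (A * Aᴴ) = homEntropy (Aᴴ * A) := by
  rw [homEntropy, homEntropy, trace_mul_comm]
  congr 1
  refine entropy_eq_of_charpoly_eq ?_ ?_ ?_
  · exact IsSelfAdjoint.smul (.all _) (isHermitian_mul_conjTranspose_self A)
  · exact IsSelfAdjoint.smul (.all _) (isHermitian_conjTranspose_mul_self A)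
  · rw [← smul_mul_assoc, charpoly_mul_comm, mul_smul_comm]

lemma sum_homEntropy_le {ι : Type*} [Fintype ι] {X : ι → Matrix n n ℂ}
    (hX : ∀ j, (X j).PosSemidef) : ∑ j, homEntropy (X j) ≤ homEntropy (∑ j, X j) := by
  set T := (∑ j, X j).trace.re with hT
  have h_sum : ∑ j, (X j).trace.re = T := by rw [hT, trace_sum, Complex.re_sum]
  rcases eq_or_ne T 0 with h0 | h0
  · have h_zero (j : ι) : (X j).trace.re = 0 :=
      (Finset.sum_eq_zero_iff_of_nonneg fun j _ => re_trace_nonneg (hX j)).1 (h_sum.trans h0) j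
        (Finset.mem_univ j)
    simp only [homEntropy, h_zero, zero_mul, Finset.sum_const_zero, ← hT, h0, le_refl]
  have hT_nonneg : 0 ≤ T := re_trace_nonneg (posSemidef_sum _ fun j _ => hX j)
  have h_smul (j : ι) : (T⁻¹ * (X j).trace.re) • (X j).trace.re⁻¹ • X j = T⁻¹ • X j := by
    rw [smul_smul]
    rcases eq_or_ne (X j).trace.re 0 with h | h
    · simp [eq_zero_of_re_trace_eq_zero (hX j) h]
    · rw [mul_assoc, mul_inv_cancel₀ h, mul_one]
  have h := sum_mul_entropy_le (w := fun j => T⁻¹ * (X j).trace.re)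
    (fun j => mul_nonneg (inv_nonneg.2 hT_nonneg) (re_trace_nonneg (hX j)))
    (by rw [← Finset.mul_sum, h_sum, inv_mul_cancel₀ h0])
    (fun j => posSemidef_inv_re_trace_smul (hX j))
  simp only [h_smul, ← Finset.smul_sum, mul_assoc, ← Finset.mul_sum] at h
  calc ∑ j, homEntropy (X j) = T * (T⁻¹ * ∑ j, homEntropy (X j)) := by
        rw [mul_inv_cancel_left₀ h0]
    _ ≤ T * entropy (T⁻¹ • ∑ j, X j) := mul_le_mul_of_nonneg_left h hT_nonneg

lemma homEntropy_mono {X Y : Matrix n n ℂ} (hX : X.PosSemidef) (h : X ≤ Y) :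
    homEntropy X ≤ homEntropy Y := by
  have h_nonneg (j : Fin 2) : (![X, Y - X] j).PosSemidef := by
    fin_cases j
    exacts [hX, le_iff.1 h]
  have h_sum := sum_homEntropy_le h_nonneg
  simp only [Fin.sum_univ_two, cons_val_zero, cons_val_one, add_sub_cancel] at h_sum
  linarith [homEntropy_nonneg (le_iff.1 h)]

lemma homEntropy_eq_sum {A : Matrix n n ℂ} (hA : A.PosSemidef) :
    homEntropy A = ∑ i, hA.1.eigenvalues i *
      (Real.log A.trace.re - Real.log (hA.1.eigenvalues i)) := by
  have h_trace := re_trace_eq_sum_eigenvalues hA.1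
  rcases eq_or_ne A.trace.re 0 with h0 | h0
  · have h_zero (i : n) : hA.1.eigenvalues i = 0 :=
      (Finset.sum_eq_zero_iff_of_nonneg fun i _ => hA.eigenvalues_nonneg i).1
        (h_trace.symm.trans h0) i (Finset.mem_univ i)
    simp [homEntropy, h0, h_zero]
  · rw [homEntropy, entropy_smul hA.1, entropy_eq_sum hA.1, mul_add, mul_inv_cancel_left₀ h0,
      Real.negMulLog, Real.log_inv, neg_mul_neg, mul_inv_cancel_left₀ h0, h_trace,
      Finset.sum_mul, ← Finset.sum_add_distrib]
    refine Finset.sum_congr rfl fun i _ => ?_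
    rw [Real.negMulLog]
    ring

end HomEntropy

section Sampling

variable {K W : Type*} [Fintype K] [Fintype W]

lemma exists_forall_norm_mean_sub_sq_le {E : Type*} [NormedAddCommGroup E]
    [InnerProductSpace ℝ E] {p : W → ℝ} (hp : ∀ v, 0 ≤ p v) (hp1 : ∑ v, p v = 1)
    (x : K → W → E) {M : ℕ} (hM : 0 < M) :
    ∃ w : Fin M → W, ∀ κ, ‖(M : ℝ)⁻¹ • ∑ μ, x κ (w μ) - ∑ v, p v • x κ v‖ ^ 2
      ≤ (∑ v, p v * ∑ κ, ‖x κ v‖ ^ 2) / M := by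
  have hM0 : (0 : ℝ) < M := by exact_mod_cast hM
  obtain ⟨w, hw⟩ := exists_norm_sum_sub_mean_sq_le hp hp1
    (fun v => (WithLp.toLp 2 fun κ => x κ v : PiLp 2 fun _ : K => E)) M
  refine ⟨w, fun κ => ?_⟩
  have h_scale : ∑ μ, (x κ (w μ) - ∑ v, p v • x κ v)
      = (M : ℝ) • ((M : ℝ)⁻¹ • ∑ μ, x κ (w μ) - ∑ v, p v • x κ v) := by
    rw [smul_sub, smul_inv_smul₀ hM0.ne', Finset.sum_sub_distrib, Finset.sum_const,
      Finset.card_univ, Fintype.card_fin, Nat.cast_smul_eq_nsmul]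
  have h_single : ‖∑ μ, (x κ (w μ) - ∑ v, p v • x κ v)‖ ^ 2
      ≤ ∑ κ, ‖∑ μ, (x κ (w μ) - ∑ v, p v • x κ v)‖ ^ 2 :=
    Finset.single_le_sum (f := fun κ => ‖∑ μ, (x κ (w μ) - ∑ v, p v • x κ v)‖ ^ 2)
      (fun κ _ => by positivity) (Finset.mem_univ κ)
  simp only [PiLp.norm_sq_eq_of_L2, WithLp.ofLp_sum, WithLp.ofLp_sub, WithLp.ofLp_smul,
    Finset.sum_apply, Pi.sub_apply, Pi.smul_apply] at hw
  replace hw := h_single.trans hw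
  rw [h_scale, norm_smul, mul_pow, Real.norm_natCast, sq (M : ℝ), mul_assoc] at hw
  rw [le_div_iff₀' hM0]
  exact le_of_mul_le_mul_left hw hM0

variable {n : Type*} [Fintype n]

lemma posSemidef_mul_self {A : Matrix n n ℂ} (hA : A.IsHermitian) : (A * A).PosSemidef := by
  simpa only [hA.eq] using posSemidef_self_mul_conjTranspose A

lemma expect_mul_self_eq_norm_hsVec_sq (Ω : Matrix n n ℂ) {D : Matrix n n ℂ}
    (hD : D.IsHermitian) : expect (Ωᴴ * Ω) (D * D) = ‖hsVec (Ω * D)‖ ^ 2 := by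
  classical
  simpa [hD.eq] using expect_conj_eq_norm_hsVec_sq Ω D 1

variable [DecidableEq n]

lemma exists_forall_expect_mean_sub_sq_le {p : W → ℝ} (hp : ∀ J, 0 ≤ p J) (hp1 : ∑ J, p J = 1)
    {Y : K → W → Matrix n n ℂ} (hY : ∀ κ J, (Y κ J).PosSemidef) {B : ℝ} (hB : 0 ≤ B)
    (hYB : ∀ κ J, Y κ J * Y κ J ≤ B • Y κ J) (hY1 : ∀ κ, ∑ J, p J • Y κ J ≤ 1)
    {ω : K → Matrix n n ℂ} (hω : ∀ κ, (ω κ).PosSemidef) {τ : ℝ} (hτ : ∀ κ, (ω κ).trace.re ≤ τ)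
    {M : ℕ} (hM : 0 < M) :
    ∃ w : Fin M → W, ∀ κ, expect (ω κ)
      (((M : ℝ)⁻¹ • ∑ μ, Y κ (w μ) - ∑ J, p J • Y κ J) *
        ((M : ℝ)⁻¹ • ∑ μ, Y κ (w μ) - ∑ J, p J • Y κ J))
      ≤ Fintype.card K * (B * τ) / M := by
  choose Ω hΩ using fun κ => exists_conjTranspose_mul_self (hω κ)
  obtain ⟨w, hw⟩ :=
    exists_forall_norm_mean_sub_sq_le hp hp1 (fun κ J => hsVec (Ω κ * Y κ J)) hM
  have h_herm (κ : K) : ((M : ℝ)⁻¹ • ∑ μ, Y κ (w μ) - ∑ J, p J • Y κ J).IsHermitian :=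
    ((posSemidef_sum _ fun μ _ => hY κ (w μ)).smul (by positivity : (0 : ℝ) ≤ (M : ℝ)⁻¹)).1.sub
      (posSemidef_sum _ fun J _ => (hY κ J).smul (hp J)).1
  have h_norm (J : W) : ∑ κ, ‖hsVec (Ω κ * Y κ J)‖ ^ 2 ≤ ∑ κ, B * expect (ω κ) (Y κ J) := by
    refine Finset.sum_le_sum fun κ _ => ?_
    rw [← expect_mul_self_eq_norm_hsVec_sq _ (hY κ J).1, ← hΩ]
    simpa only [map_smul, smul_eq_mul] using expect_mono (hω κ) (hYB κ J)
  have h_total : ∑ J, p J * ∑ κ, ‖hsVec (Ω κ * Y κ J)‖ ^ 2 ≤ Fintype.card K * (B * τ) := by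
    calc ∑ J, p J * ∑ κ, ‖hsVec (Ω κ * Y κ J)‖ ^ 2
        ≤ ∑ J, p J * ∑ κ, B * expect (ω κ) (Y κ J) :=
          Finset.sum_le_sum fun J _ => mul_le_mul_of_nonneg_left (h_norm J) (hp J)
      _ = ∑ κ, B * expect (ω κ) (∑ J, p J • Y κ J) := by
          simp only [map_sum, map_smul, smul_eq_mul, Finset.mul_sum, mul_left_comm]
          rw [Finset.sum_comm]
      _ ≤ ∑ _κ : K, B * τ := by
          refine Finset.sum_le_sum fun κ _ => mul_le_mul_of_nonneg_left ?_ hB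
          exact (expect_mono (hω κ) (hY1 κ)).trans ((expect_one _).trans_le (hτ κ))
      _ = Fintype.card K * (B * τ) := by simp
  refine ⟨w, fun κ => ?_⟩
  rw [hΩ, expect_mul_self_eq_norm_hsVec_sq _ (h_herm κ), mul_sub, mul_smul_comm, map_sub,
    map_smul, Finset.mul_sum, Finset.mul_sum, map_sum, map_sum]
  simp only [mul_smul_comm, map_smul]
  exact (hw κ).trans (by gcongr)

lemma truncation_conj_le_one {S G Y : Matrix n n ℂ} (hΔ : (S - G).IsHermitian) (hG : G ≤ 1)
    (hY : Y ≤ S) : truncation (S - G) * Y * truncation (S - G) ≤ 1 := by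
  have h_le : Y ≤ 1 + (S - G) := by
    simpa only [add_sub_cancel] using add_le_add hG (sub_le_sub_right hY G)
  have h_conj := conjTranspose_mul_mul_le h_le (truncation (S - G))
  rw [(isHermitian_truncation _).eq] at h_conj
  exact h_conj.trans (truncation_mul_one_add_mul_truncation_le hΔ)

lemma truncation_sub_one_conj_le {S G Y : Matrix n n ℂ} (hΔ : (S - G).IsHermitian) (hG : G ≤ 1)
    (hY : Y ≤ S) :
    (truncation (S - G) - 1) * Y * (truncation (S - G) - 1) ≤ (S - G) * (S - G) := by
  have h_le : Y ≤ 1 + (S - G) := by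
    simpa only [add_sub_cancel] using add_le_add hG (sub_le_sub_right hY G)
  have h_conj := conjTranspose_mul_mul_le h_le (truncation (S - G) - 1)
  rw [((isHermitian_truncation _).sub isHermitian_one).eq] at h_conj
  exact h_conj.trans (truncation_sub_one_mul_one_add_mul_le hΔ)

lemma abs_expect_truncation_conj_sub_le {S G Y E σ : Matrix n n ℂ} (hΔ : (S - G).IsHermitian)
    (hG : G ≤ 1) (hY : Y.PosSemidef) (hYS : Y ≤ S) (hE : E.IsHermitian) (hσ : σ.PosSemidef)
    (hσ1 : σ.trace = 1) {δ : ℝ} (hδ : δ ≤ 1) (hSG : expect σ ((S - G) * (S - G)) ≤ δ)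
    (hYE : expect σ ((Y - E) * (Y - E)) ≤ δ) :
    |expect σ (truncation (S - G) * Y * truncation (S - G)) - expect σ E| ≤ 4 * √δ := by
  set T := truncation (S - G) with hT
  have h_one : expect σ 1 = 1 := by rw [expect_one, hσ1, Complex.one_re]
  have h_sqrt : √δ ≤ 1 := Real.sqrt_le_one.2 hδ
  have hYE' : |expect σ Y - expect σ E| ≤ √δ := by
    rw [← map_sub]
    exact (abs_expect_le_sqrt hσ hσ1 (hY.1.sub hE)).trans (Real.sqrt_le_sqrt hYE)
  have hSG' : |expect σ S - expect σ G| ≤ √δ := by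
    rw [← map_sub]
    exact (abs_expect_le_sqrt hσ hσ1 hΔ).trans (Real.sqrt_le_sqrt hSG)
  have h_sqrt_Y : √(expect σ Y) ≤ 2 := by
    refine Real.sqrt_le_iff.2 ⟨by norm_num, ?_⟩
    linarith [expect_mono hσ hYS, expect_mono hσ hG, le_abs_self (expect σ S - expect σ G)]
  have h_sqrt_TYT : √(expect σ (T * Y * T)) ≤ 1 :=
    Real.sqrt_le_one.2 <| h_one ▸ expect_mono hσ (truncation_conj_le_one hΔ hG hYS)
  have h_sqrt_sub : √(expect σ ((T - 1) * Y * (T - 1))) ≤ √δ :=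
    Real.sqrt_le_sqrt ((expect_mono hσ (truncation_sub_one_conj_le hΔ hG hYS)).trans hSG)
  have h_gentle : |expect σ (T * Y * T) - expect σ Y| ≤ √δ * (1 + 2) := by
    have h := abs_expect_conj_sub_le hσ hY T
    rw [conjTranspose_sub, conjTranspose_one, hT, (isHermitian_truncation _).eq, ← hT] at h
    exact h.trans (by gcongr)
  linarith [abs_sub_le (expect σ (T * Y * T)) (expect σ Y) (expect σ E)]

lemma exists_sample_forall_subset [DecidableEq W] {p : W → ℝ} (hp : ∀ J, 0 ≤ p J)
    (hp1 : ∑ J, p J = 1) {X : W → Matrix n n ℂ} (hX : ∀ J, (X J).PosSemidef) {B : ℝ} (hB : 0 ≤ B)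
    (hXB : ∀ J, X J * X J ≤ B • X J) (hX1 : ∑ J, p J • X J ≤ 1)
    {ω : K → Matrix n n ℂ} (hω : ∀ κ, (ω κ).PosSemidef) {τ : ℝ} (hτ : ∀ κ, (ω κ).trace.re ≤ τ)
    (S : K → Finset W) {M : ℕ} (hM : 0 < M) :
    ∃ w : Fin M → W, ∀ κ, ∀ s ∈ ({Finset.univ, S κ} : Set (Finset W)), expect (ω κ)
      (((M : ℝ)⁻¹ • ∑ μ with w μ ∈ s, X (w μ) - ∑ J ∈ s, p J • X J) *
        ((M : ℝ)⁻¹ • ∑ μ with w μ ∈ s, X (w μ) - ∑ J ∈ s, p J • X J))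
      ≤ 2 * Fintype.card K * (B * τ) / M := by
  let s (κ : K × Bool) : Finset W := if κ.2 then S κ.1 else Finset.univ
  let Y (κ : K × Bool) (J : W) : Matrix n n ℂ := if J ∈ s κ then X J else 0
  have hY (κ J) : (Y κ J).PosSemidef := by
    dsimp only [Y]; split_ifs; exacts [hX J, .zero]
  have hYX (κ J) : Y κ J ≤ X J := by
    dsimp only [Y]; split_ifs; exacts [le_rfl, (hX J).nonneg]
  have hYB (κ J) : Y κ J * Y κ J ≤ B • Y κ J := by
    dsimp only [Y]; split_ifs; exacts [hXB J, by simp]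
  have h_weighted (κ) : ∑ J, p J • Y κ J ≤ ∑ J, p J • X J :=
    Finset.sum_le_sum fun J _ => smul_le_smul_of_nonneg_left (hYX κ J) (hp J)
  obtain ⟨w, hw⟩ := exists_forall_expect_mean_sub_sq_le hp hp1 hY hB hYB
    (fun κ => (h_weighted κ).trans hX1) (ω := fun κ => ω κ.1) (fun κ => hω κ.1)
    (fun κ => hτ κ.1) hM
  simp only [Y, smul_ite, smul_zero, ← Finset.sum_filter, Fintype.card_prod, Fintype.card_bool,
    Nat.cast_mul, Nat.cast_ofNat, mul_comm (Fintype.card K : ℝ) 2] at hw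
  refine ⟨w, fun κ t ht => ?_⟩
  rcases ht with rfl | rfl
  · simpa [s] using hw (κ, false)
  · simpa [s] using hw (κ, true)

lemma exists_compressed [DecidableEq W] {p : W → ℝ} (hp : ∀ J, 0 ≤ p J) (hp1 : ∑ J, p J = 1)
    {X : W → Matrix n n ℂ} (hX : ∀ J, (X J).PosSemidef) {B : ℝ} (hB : 0 ≤ B)
    (hXB : ∀ J, X J * X J ≤ B • X J) (hX1 : ∑ J, p J • X J ≤ 1)
    {ω : K → Matrix n n ℂ} (hω : ∀ κ, (ω κ).PosSemidef) {τ : ℝ} (hτ : ∀ κ, (ω κ).trace.re ≤ τ)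
    (S : K → Finset W) {δ : ℝ} (hδ : δ ≤ 1) {M : ℕ} (hM : 0 < M)
    (hKM : 2 * Fintype.card K * (B * τ) ≤ δ * M) :
    ∃ (w : Fin M → W) (A : Fin M → Matrix n n ℂ), (∀ μ, (A μ).PosSemidef) ∧ ∑ μ, A μ ≤ 1 ∧
      ∀ κ (σ : Matrix n n ℂ), σ.PosSemidef → σ.trace = 1 → σ ≤ ω κ →
        |expect σ (∑ μ with w μ ∈ S κ, A μ) - expect σ (∑ J ∈ S κ, p J • X J)| ≤ 4 * √δ := by
  obtain ⟨w, hw⟩ := exists_sample_forall_subset hp hp1 hX hB hXB hX1 hω hτ S hM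
  have hM_inv : (0 : ℝ) ≤ (M : ℝ)⁻¹ := by positivity
  have hR (s : Finset (Fin M)) : ((M : ℝ)⁻¹ • ∑ μ ∈ s, X (w μ)).PosSemidef :=
    (posSemidef_sum _ fun μ _ => hX (w μ)).smul hM_inv
  have hG (s : Finset W) : (∑ J ∈ s, p J • X J).PosSemidef :=
    posSemidef_sum _ fun J _ => (hX J).smul (hp J)
  set T := truncation ((M : ℝ)⁻¹ • ∑ μ, X (w μ) - ∑ J, p J • X J)
  have hΔ := (hR Finset.univ).1.sub (hG Finset.univ).1
  have h_sum (s : Finset (Fin M)) : ∑ μ ∈ s, (M : ℝ)⁻¹ • (T * X (w μ) * T)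
      = T * ((M : ℝ)⁻¹ • ∑ μ ∈ s, X (w μ)) * T := by
    rw [← Finset.smul_sum, ← Matrix.sum_mul, ← Matrix.mul_sum, mul_smul_comm, smul_mul_assoc]
  refine ⟨w, fun μ => (M : ℝ)⁻¹ • (T * X (w μ) * T), fun μ => ?_, ?_, fun κ σ hσ hσ1 hσω => ?_⟩
  · have h_conj := (hX (w μ)).mul_mul_conjTranspose_same T
    rw [(isHermitian_truncation _).eq] at h_conj
    exact h_conj.smul hM_inv
  · rw [h_sum]
    exact truncation_conj_le_one hΔ hX1 le_rfl
  have h_err {s : Finset W} (hs : s ∈ ({Finset.univ, S κ} : Set (Finset W))) :=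
    (expect_mono_left (posSemidef_mul_self ((hR {μ | w μ ∈ s}).1.sub (hG s).1)) hσω).trans
      ((hw κ s hs).trans ((div_le_iff₀ (by exact_mod_cast hM)).2 hKM))
  rw [h_sum]
  refine abs_expect_truncation_conj_sub_le hΔ hX1 (hR _) ?_ (hG _).1 hσ hσ1 hδ ?_
    (h_err (by simp))
  · exact smul_le_smul_of_nonneg_left (Finset.sum_le_univ_sum_of_nonneg fun μ => (hX _).nonneg)
      hM_inv
  · simpa using h_err (s := Finset.univ) (by simp)

end Sampling

section CanonicalEnsemble

variable {n ι : Type} [Fintype n] [DecidableEq n] {ρ : Matrix n n ℂ} {a : ι → Matrix n n ℂ}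

lemma isHermitian_cfc_sqrt (ρ : Matrix n n ℂ) : (cfc Real.sqrt ρ).IsHermitian :=
  cfc_predicate (R := ℝ) Real.sqrt ρ

lemma cfc_sqrt_mul_cfc_sqrt (hρ : ρ.PosSemidef) : cfc Real.sqrt ρ * cfc Real.sqrt ρ = ρ := by
  have hρ' : IsSelfAdjoint ρ := hρ.1
  rw [← cfc_mul _ _ ρ (finite_real_spectrum.continuousOn _) (finite_real_spectrum.continuousOn _)]
  conv_rhs => rw [← cfc_id ℝ ρ]
  exact cfc_congr fun x hx => Real.mul_self_sqrt (spectrum_nonneg_of_nonneg hρ.nonneg hx)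

lemma outcomeProb_mul_entropy_canonicalState (hρ : ρ.PosSemidef) (j : ι) :
    outcomeProb ρ a j * entropy (canonicalState ρ a j)
      = homEntropy (cfc Real.sqrt ρ * a j * cfc Real.sqrt ρ) := by
  have h_trace : outcomeProb ρ a j = (cfc Real.sqrt ρ * a j * cfc Real.sqrt ρ).trace.re := by
    rw [trace_mul_cycle, cfc_sqrt_mul_cfc_sqrt hρ, outcomeProb]
  rw [homEntropy, canonicalState, h_trace]

lemma homEntropy_cfc_sqrt_conj (hρ : ρ.PosSemidef) (N : Matrix n n ℂ) :
    homEntropy (cfc Real.sqrt ρ * (N * Nᴴ) * cfc Real.sqrt ρ) = homEntropy (Nᴴ * ρ * N) := by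
  have h := homEntropy_mul_conjTranspose_comm (cfc Real.sqrt ρ * N)
  rw [conjTranspose_mul, (isHermitian_cfc_sqrt ρ).eq] at h
  convert h using 2
  · simp only [mul_assoc]
  · rw [mul_assoc _ (cfc Real.sqrt ρ), ← mul_assoc (cfc Real.sqrt ρ), cfc_sqrt_mul_cfc_sqrt hρ,
      mul_assoc]

variable [Fintype ι]

lemma outcomeProb_nonneg (hρ : ρ.PosSemidef) (ha : IsPOVM a) (j : ι) : 0 ≤ outcomeProb ρ a j :=
  expect_nonneg hρ (ha.posSemidef j)

lemma sum_outcomeProb (hρ1 : ρ.trace = 1) (ha : IsPOVM a) : ∑ j, outcomeProb ρ a j = 1 := by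
  change ∑ j, expect ρ (a j) = 1
  rw [← map_sum, ha.sum_eq_one, expect_one, hρ1, Complex.one_re]

lemma entropyDefect_nonneg (hρ : ρ.PosSemidef) (hρ1 : ρ.trace = 1) (ha : IsPOVM a) :
    0 ≤ entropyDefect ρ a := by
  have h_nonneg (j : ι) : (cfc Real.sqrt ρ * a j * cfc Real.sqrt ρ).PosSemidef := by
    simpa only [(isHermitian_cfc_sqrt ρ).eq]
      using (ha.posSemidef j).mul_mul_conjTranspose_same (cfc Real.sqrt ρ)
  have h := sum_homEntropy_le h_nonneg
  rw [← Matrix.sum_mul, ← Matrix.mul_sum, ha.sum_eq_one, mul_one, cfc_sqrt_mul_cfc_sqrt hρ,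
    homEntropy_of_trace_eq_one hρ1] at h
  simpa only [entropyDefect, outcomeProb_mul_entropy_canonicalState hρ, sub_nonneg] using h

lemma entropyDefect_eq_sub_sum_homEntropy (hρ : ρ.PosSemidef) {N : ι → Matrix n n ℂ}
    (hN : ∀ j, a j = N j * (N j)ᴴ) :
    entropyDefect ρ a = entropy ρ - ∑ j, homEntropy ((N j)ᴴ * ρ * N j) := by
  simp only [entropyDefect, outcomeProb_mul_entropy_canonicalState hρ, hN,
    homEntropy_cfc_sqrt_conj hρ]

lemma sum_re_trace_conj (hρ1 : ρ.trace = 1) (ha : IsPOVM a) {N : ι → Matrix n n ℂ}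
    (hN : ∀ j, a j = N j * (N j)ᴴ) : ∑ j, ((N j)ᴴ * ρ * N j).trace.re = 1 := by
  rw [← sum_outcomeProb hρ1 ha]
  refine Finset.sum_congr rfl fun j _ => ?_
  rw [outcomeProb, hN, trace_mul_cycle, trace_mul_comm]

lemma exists_factorization_conj_eq_diagonal {A : Matrix n n ℂ} (hρ : ρ.PosSemidef)
    (hA : A.PosSemidef) :
    ∃ (N : Matrix n n ℂ) (s : n → ℝ), A = N * Nᴴ ∧ 0 ≤ s ∧
      Nᴴ * ρ * N = diagonal (fun i => (s i : ℂ)) ∧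
      homEntropy (cfc Real.sqrt ρ * A * cfc Real.sqrt ρ)
        = ∑ i, s i * (Real.log (ρ * A).trace.re - Real.log (s i)) := by
  obtain ⟨N, rfl⟩ := exists_self_mul_conjTranspose hA
  have h_nonneg := hρ.conjTranspose_mul_mul_same N
  obtain ⟨V, -, hV, h_diag⟩ := exists_diagonalization h_nonneg.1
  have h_conj : (N * V)ᴴ * ρ * (N * V) = Vᴴ * (Nᴴ * ρ * N) * V := by
    simp only [conjTranspose_mul, mul_assoc]
  have h_trace : (ρ * (N * Nᴴ)).trace = (Nᴴ * ρ * N).trace := by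
    rw [trace_mul_cycle Nᴴ, trace_mul_comm]
  refine ⟨N * V, h_nonneg.1.eigenvalues, ?_, h_nonneg.eigenvalues_nonneg, h_conj.trans h_diag, ?_⟩
  · rw [conjTranspose_mul, mul_assoc, ← mul_assoc V, hV, one_mul]
  · rw [homEntropy_cfc_sqrt_conj hρ, homEntropy_eq_sum h_nonneg, h_trace]

end CanonicalEnsemble

section Depolarize

variable {n : Type} [Fintype n] [DecidableEq n] {ρ : Matrix n n ℂ}

/-- The depolarized state `(1 - t) ρ + t 1 / d`: a full-rank perturbation of `ρ`. -/
def depolarize (t : ℝ) (ρ : Matrix n n ℂ) : Matrix n n ℂ :=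
  (1 - t) • ρ + (t / Fintype.card n) • 1

variable {t : ℝ}

lemma smul_le_depolarize (ht : 0 ≤ t) (ρ : Matrix n n ℂ) : (1 - t) • ρ ≤ depolarize t ρ :=
  le_add_of_nonneg_right (PosSemidef.one.smul (by positivity)).nonneg

lemma smul_one_le_depolarize (hρ : ρ.PosSemidef) (ht : t ≤ 1) :
    (t / Fintype.card n) • 1 ≤ depolarize t ρ :=
  le_add_of_nonneg_left (hρ.smul (sub_nonneg.2 ht)).nonneg

lemma posSemidef_depolarize (hρ : ρ.PosSemidef) (ht0 : 0 ≤ t) (ht1 : t ≤ 1) :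
    (depolarize t ρ).PosSemidef :=
  (hρ.smul (sub_nonneg.2 ht1)).add (PosSemidef.one.smul (by positivity))

lemma trace_depolarize [Nonempty n] (hρ1 : ρ.trace = 1) (t : ℝ) : (depolarize t ρ).trace = 1 := by
  rw [depolarize, trace_add, trace_smul, trace_smul, hρ1, trace_one]
  simp [Complex.real_smul]

lemma entropy_add_smul_one_le {A : Matrix n n ℂ} (hA : A.PosSemidef) {c : ℝ} (hc : 0 ≤ c) :
    entropy (A + c • 1) ≤ entropy A + Fintype.card n * Real.negMulLog c := by
  have hA' : IsSelfAdjoint A := hA.1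
  have h_cfc : A + c • 1 = cfc (fun x : ℝ => x + c) A := by
    rw [cfc_add_const .., cfc_id' .., Algebra.algebraMap_eq_smul_one]
  calc entropy (A + c • 1) = ∑ i, Real.negMulLog (hA.1.eigenvalues i + c) := by
        rw [h_cfc, entropy_cfc hA.1]
    _ ≤ ∑ i, (Real.negMulLog (hA.1.eigenvalues i) + Real.negMulLog c) :=
        Finset.sum_le_sum fun i _ => negMulLog_add_le (hA.eigenvalues_nonneg i) hc
    _ = entropy A + Fintype.card n * Real.negMulLog c := by
        rw [Finset.sum_add_distrib, ← entropy_eq_sum, Finset.sum_const, nsmul_eq_mul,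
          Finset.card_univ]

lemma entropy_depolarize_le [Nonempty n] (hρ : ρ.PosSemidef) (hρ1 : ρ.trace = 1) (ht0 : 0 ≤ t)
    (ht1 : t ≤ 1) :
    entropy (depolarize t ρ) ≤ entropy ρ + t + t * Real.log (Fintype.card n / t) := by
  have h_card : (0 : ℝ) < Fintype.card n := by exact_mod_cast Fintype.card_pos
  have h_smul : entropy ((1 - t) • ρ) ≤ entropy ρ + t := by
    have h_log := Real.negMulLog_le_one_sub_self (sub_nonneg.2 ht1)
    have h_entropy := mul_nonneg ht0 (entropy_nonneg hρ (by simp [hρ1]))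
    rw [entropy_smul hρ.1, hρ1, Complex.one_re]
    linarith
  have h_one : Fintype.card n * Real.negMulLog (t / Fintype.card n)
      = t * Real.log (Fintype.card n / t) := by
    rw [Real.negMulLog, ← inv_div, Real.log_inv]
    field_simp
  have h_add := entropy_add_smul_one_le (hρ.smul (sub_nonneg.2 ht1)) (div_nonneg ht0 h_card.le)
  rw [h_one] at h_add
  exact h_add.trans (by gcongr)

lemma entropyDefect_depolarize_le {ι : Type} [Fintype ι] {a : ι → Matrix n n ℂ} [Nonempty n]
    (hρ : ρ.PosSemidef) (hρ1 : ρ.trace = 1) (ha : IsPOVM a) (ht0 : 0 ≤ t) (ht1 : t ≤ 1) :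
    entropyDefect (depolarize t ρ) a ≤ entropyDefect ρ a +
      (t + t * Real.log (Fintype.card n / t) + t * Fintype.card n) := by
  choose N hN using fun j => exists_self_mul_conjTranspose (ha.posSemidef j)
  rw [entropyDefect_eq_sub_sum_homEntropy hρ hN,
    entropyDefect_eq_sub_sum_homEntropy (posSemidef_depolarize hρ ht0 ht1) hN]
  have h_conj (j : ι) : ((N j)ᴴ * ρ * N j).PosSemidef := hρ.conjTranspose_mul_mul_same _
  have h_mono (j : ι) : (1 - t) * homEntropy ((N j)ᴴ * ρ * N j)
      ≤ homEntropy ((N j)ᴴ * depolarize t ρ * N j) := by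
    rw [← homEntropy_smul]
    refine homEntropy_mono ((h_conj j).smul (sub_nonneg.2 ht1)) ?_
    simpa only [mul_smul_comm, smul_mul_assoc]
      using conjTranspose_mul_mul_le (smul_le_depolarize ht0 ρ) (N j)
  have h_sum := Finset.sum_le_sum fun j (_ : j ∈ Finset.univ) => h_mono j
  have h_card : ∑ j, homEntropy ((N j)ᴴ * ρ * N j) ≤ Fintype.card n := by
    refine (Finset.sum_le_sum fun j _ => homEntropy_le_card_mul_trace (h_conj j)).trans_eq ?_
    rw [← Finset.mul_sum, sum_re_trace_conj hρ1 ha hN, mul_one]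
  rw [← Finset.mul_sum] at h_sum
  linarith [entropy_depolarize_le hρ hρ1 ht0 ht1, mul_le_mul_of_nonneg_left h_card ht0]

end Depolarize

section CoordProj

variable {W : Type*} [DecidableEq W]

/-- The projection onto the span of the basis vectors in `S`. -/
def coordProj (S : Finset W) : Matrix W W ℂ :=
  diagonal fun y => if y ∈ S then 1 else 0

lemma coordProj_le_diagonal (S : Finset W) {f : W → ℝ} (hf0 : 0 ≤ f) (hf : ∀ y ∈ S, 1 ≤ f y) :
    coordProj S ≤ diagonal fun y => (f y : ℂ) := by
  rw [coordProj, le_iff, diagonal_sub]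
  refine PosSemidef.diagonal fun y => ?_
  by_cases hy : y ∈ S
  · simpa [hy, ← Complex.ofReal_one, -Complex.coe_algebraMap] using hf y hy
  · simpa [hy] using hf0 y

variable [Fintype W]

lemma isStarProjection_coordProj (S : Finset W) : IsStarProjection (coordProj S) where
  isIdempotentElem := by simp [IsIdempotentElem, coordProj, diagonal_mul_diagonal]
  isSelfAdjoint := by
    rw [IsSelfAdjoint, star_eq_conjTranspose, coordProj, diagonal_conjTranspose]
    congr 1
    ext y
    simp [apply_ite star]

lemma one_sub_coordProj (S : Finset W) : 1 - coordProj S = coordProj Sᶜ := by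
  rw [coordProj, coordProj, ← diagonal_one, diagonal_sub]
  congr 1
  ext y
  by_cases hy : y ∈ S <;> simp [hy]

lemma coordProj_mul_diagonal_mul_coordProj_le (S : Finset W) {f : W → ℝ} {b : ℝ} (hb : 0 ≤ b)
    (hf : ∀ y ∈ S, f y ≤ b) :
    coordProj S * diagonal (fun y => (f y : ℂ)) * coordProj S ≤ b • 1 := by
  have h_smul : b • (1 : Matrix W W ℂ) = diagonal fun _ => (b : ℂ) := by
    rw [← diagonal_one, ← diagonal_smul]
    congr 1
    ext y
    simp
  rw [coordProj, diagonal_mul_diagonal, diagonal_mul_diagonal, h_smul, le_iff, diagonal_sub]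
  refine PosSemidef.diagonal fun y => ?_
  by_cases hy : y ∈ S
  · simpa [hy] using hf y hy
  · simpa [hy] using hb

lemma expect_coordProj (ω : Matrix W W ℂ) (S : Finset W) :
    expect ω (coordProj S) = ∑ y ∈ S, (ω y y).re := by
  simp [expect_apply, coordProj, trace, mul_diagonal, apply_ite, Finset.sum_ite_mem]

end CoordProj

section Projection

variable {n : Type*} [Fintype n] [DecidableEq n] {P Y : Matrix n n ℂ}

lemma mul_conjTranspose_mul_self_le {Q : Matrix n n ℂ} {b : ℝ} (h : Qᴴ * Q ≤ b • 1) :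
    (Q * Qᴴ) * (Q * Qᴴ) ≤ b • (Q * Qᴴ) := by
  have h_conj := mul_mul_conjTranspose_le h Q
  rwa [mul_smul_comm, smul_mul_assoc, mul_one, ← mul_assoc Q, mul_assoc (Q * Qᴴ)] at h_conj

lemma projection_conj_le_one (hP : IsStarProjection P) (hY1 : Y ≤ 1) : P * Y * P ≤ 1 := by
  have h := conjTranspose_mul_mul_le hY1 P
  rw [← star_eq_conjTranspose, hP.isSelfAdjoint, mul_one, hP.isIdempotentElem] at h
  exact h.trans hP.le_one

lemma abs_expect_projection_conj_sub_le {σ : Matrix n n ℂ} (hσ : σ.PosSemidef)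
    (hσ1 : σ.trace = 1) (hP : IsStarProjection P) (hY : Y.PosSemidef) (hY1 : Y ≤ 1) :
    |expect σ (P * Y * P) - expect σ Y| ≤ 2 * √(expect σ (1 - P)) := by
  have h_one : expect σ 1 = 1 := by rw [expect_one, hσ1, Complex.one_re]
  have h_star : Pᴴ = P := hP.isSelfAdjoint
  have h_sub_star : (P - 1)ᴴ = P - 1 := by rw [conjTranspose_sub, h_star, conjTranspose_one]
  have h_sub : (P - 1) * Y * (P - 1) ≤ 1 - P := by
    have h := mul_mul_conjTranspose_le hY1 (P - 1)
    rwa [h_sub_star, mul_one, ← neg_sub 1 P, neg_mul_neg, hP.one_sub.isIdempotentElem,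
      neg_sub] at h
  have h_gentle := abs_expect_conj_sub_le hσ hY P
  rw [h_star, h_sub_star] at h_gentle
  have h_sqrt₁ := Real.sqrt_le_sqrt (expect_mono hσ h_sub)
  have h_sqrt₂ := Real.sqrt_le_one.2
    ((expect_mono hσ (projection_conj_le_one hP hY1)).trans_eq h_one)
  have h_sqrt₃ := Real.sqrt_le_one.2 ((expect_mono hσ hY1).trans_eq h_one)
  calc |expect σ (P * Y * P) - expect σ Y| ≤ √(expect σ (1 - P)) * (1 + 1) := by
        refine h_gentle.trans ?_
        gcongr
    _ = 2 * √(expect σ (1 - P)) := by ring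

end Projection

section LogSquare

lemma mul_log_sq_le {x : ℝ} (h0 : 0 ≤ x) (h1 : x ≤ 1) : x * Real.log x ^ 2 ≤ 4 := by
  have h_nonneg := Real.negMulLog_nonneg (Real.sqrt_nonneg x) (Real.sqrt_le_one.2 h1)
  have h_le : Real.negMulLog √x ≤ 1 :=
    (Real.negMulLog_le_one_sub_self (Real.sqrt_nonneg x)).trans
      (sub_le_self 1 (Real.sqrt_nonneg x))
  calc x * Real.log x ^ 2 = 4 * Real.negMulLog √x ^ 2 := by
        rw [Real.negMulLog, Real.log_sqrt h0, mul_pow, neg_sq, Real.sq_sqrt h0]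
        ring
    _ ≤ 4 := by nlinarith

lemma mul_log_sub_log_sq_le {x y : ℝ} (hx : 0 ≤ x) (hxy : x ≤ y) :
    x * (Real.log y - Real.log x) ^ 2 ≤ 4 * y := by
  obtain rfl | hx0 := hx.eq_or_lt
  · simpa using hxy
  have hy := hx0.trans_le hxy
  have h := mul_log_sq_le (div_nonneg hx hy.le) ((div_le_one hy).2 hxy)
  rw [Real.log_div hx0.ne' hy.ne', div_mul_eq_mul_div, div_le_iff₀ hy] at h
  rwa [← neg_sub, neg_sq]

end LogSquare

section DiagonalFactorization

variable {n γ : Type} [Fintype n] [DecidableEq n]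

/-- A factorization `a_j = N_j N_jᴴ` of a measurement which diagonalizes the operators
`N_jᴴ ρ N_j`, hence, up to unitary equivalence, also the states of the canonical ensemble. The
numbers `s j y` are the probabilities of the letters `(j, y)`. -/
structure IsDiagonalFactorization (ρ : Matrix n n ℂ) (a N : γ → Matrix n n ℂ) (s : γ → n → ℝ) :
    Prop where
  eq_mul_conjTranspose : ∀ j, a j = N j * (N j)ᴴ
  conj_eq_diagonal : ∀ j, (N j)ᴴ * ρ * N j = diagonal fun y => (s j y : ℂ)
  homEntropy_eq_sum : ∀ j, homEntropy (cfc Real.sqrt ρ * a j * cfc Real.sqrt ρ)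
    = ∑ y, s j y * (Real.log (outcomeProb ρ a j) - Real.log (s j y))

/-- The information density `log (λ_j / s j y)` of the letter `(j, y)`, whose mean is the average
entropy of the canonical ensemble. -/
def infoDensity (ρ : Matrix n n ℂ) (a : γ → Matrix n n ℂ) (s : γ → n → ℝ) (c : γ × n) : ℝ :=
  Real.log (outcomeProb ρ a c.1) - Real.log (s c.1 c.2)

variable {ρ : Matrix n n ℂ} {a N : γ → Matrix n n ℂ} {s : γ → n → ℝ}

lemma exists_isDiagonalFactorization [Fintype γ] (hρ : ρ.PosSemidef) (ha : IsPOVM a) :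
    ∃ N s, IsDiagonalFactorization ρ a N s := by
  choose N s h_eq _ h_diag h_hom using
    fun j => exists_factorization_conj_eq_diagonal hρ (ha.posSemidef j)
  exact ⟨N, s, h_eq, h_diag, h_hom⟩

namespace IsDiagonalFactorization

variable (h : IsDiagonalFactorization ρ a N s)

include h

lemma re_conj_apply (j : γ) (y : n) : (((N j)ᴴ * ρ * N j) y y).re = s j y := by
  rw [h.conj_eq_diagonal, diagonal_apply_eq, Complex.ofReal_re]

lemma nonneg (hρ : ρ.PosSemidef) (j : γ) (y : n) : 0 ≤ s j y := by
  rw [← h.re_conj_apply]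
  exact (Complex.le_def.1 (hρ.conjTranspose_mul_mul_same (N j)).diag_nonneg).1

lemma sum_eq_outcomeProb (j : γ) : ∑ y, s j y = outcomeProb ρ a j := by
  rw [outcomeProb, h.eq_mul_conjTranspose, ← mul_assoc, trace_mul_comm, ← mul_assoc, trace,
    Complex.re_sum]
  exact Finset.sum_congr rfl fun y _ => (h.re_conj_apply j y).symm

lemma le_outcomeProb (hρ : ρ.PosSemidef) (j : γ) (y : n) : s j y ≤ outcomeProb ρ a j := by
  rw [← h.sum_eq_outcomeProb]
  exact Finset.single_le_sum (fun z _ => h.nonneg hρ j z) (Finset.mem_univ y)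

lemma infoDensity_nonneg (hρ : ρ.PosSemidef) {c : γ × n} (hc : 0 < s c.1 c.2) :
    0 ≤ infoDensity ρ a s c :=
  sub_nonneg.2 (Real.log_le_log hc (h.le_outcomeProb hρ c.1 c.2))

variable [Fintype γ]

lemma sum_mul_infoDensity : ∑ c : γ × n, s c.1 c.2 * infoDensity ρ a s c
    = ∑ j, homEntropy (cfc Real.sqrt ρ * a j * cfc Real.sqrt ρ) := by
  rw [Fintype.sum_prod_type]
  exact Finset.sum_congr rfl fun j _ => (h.homEntropy_eq_sum j).symm

lemma sum_mul_infoDensity_sq_le (hρ : ρ.PosSemidef) (hρ1 : ρ.trace = 1) (ha : IsPOVM a) :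
    ∑ c : γ × n, s c.1 c.2 * infoDensity ρ a s c ^ 2 ≤ 4 * Fintype.card n := by
  calc ∑ c : γ × n, s c.1 c.2 * infoDensity ρ a s c ^ 2
      ≤ ∑ c : γ × n, 4 * outcomeProb ρ a c.1 := Finset.sum_le_sum fun c _ =>
        mul_log_sub_log_sq_le (h.nonneg hρ c.1 c.2) (h.le_outcomeProb hρ c.1 c.2)
    _ = 4 * Fintype.card n := by
        rw [Fintype.sum_prod_type]
        simp only [Finset.sum_const, Finset.card_univ, nsmul_eq_mul, ← Finset.mul_sum,
          sum_outcomeProb hρ1 ha]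
        ring

end IsDiagonalFactorization

end DiagonalFactorization

section Cut

variable {l d : ℕ} {γ : Type}

/-- The weight which the operator `F` gives to the `y`-th vector in the factorization
`a_j = ∑_y |N_j e_y⟩⟨N_j e_y|`. -/
def letterWeight (N : γ → Matrix (Fin d) (Fin d) ℂ) (F : Matrix (Fin d) (Fin d) ℂ)
    (c : γ × Fin d) : ℝ :=
  (((N c.1)ᴴ * F * N c.1) c.2 c.2).re

lemma letterWeight_nonneg (N : γ → Matrix (Fin d) (Fin d) ℂ) {F : Matrix (Fin d) (Fin d) ℂ}
    (hF : F.PosSemidef) : 0 ≤ letterWeight N F :=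
  fun c => (Complex.le_def.1 (hF.conjTranspose_mul_mul_same (N c.1)).diag_nonneg).1

lemma ofReal_letterWeight (N : γ → Matrix (Fin d) (Fin d) ℂ) {F : Matrix (Fin d) (Fin d) ℂ}
    (hF : F.PosSemidef) (c : γ × Fin d) :
    (letterWeight N F c : ℂ) = ((N c.1)ᴴ * F * N c.1) c.2 c.2 :=
  Complex.ext rfl (Complex.le_def.1 (hF.conjTranspose_mul_mul_same (N c.1)).diag_nonneg).2

lemma sum_letterWeight [Fintype γ] {N : γ → Matrix (Fin d) (Fin d) ℂ}
    (hN : ∑ j, N j * (N j)ᴴ = 1) (F : Matrix (Fin d) (Fin d) ℂ) :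
    ∑ c, letterWeight N F c = F.trace.re := by
  have h_expect (j : γ) : ∑ y, letterWeight N F (j, y) = expect F (N j * (N j)ᴴ) := by
    have h_conj := expect_conj F (N j) 1
    rw [mul_one, expect_one, trace, Complex.re_sum] at h_conj
    exact h_conj.symm
  rw [Fintype.sum_prod_type]
  simp only [h_expect, ← map_sum, hN, expect_one]

variable [DecidableEq γ]

/-- The product operator `a_{J_1} ⊗ ⋯ ⊗ a_{J_l}`, where `a_j = N_j N_jᴴ`, restricted to those of
its rank-one summands whose letters form a word in `S`. -/
def cut (N : γ → Matrix (Fin d) (Fin d) ℂ) (S : Finset (Fin l → γ × Fin d)) (J : Fin l → γ) :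
    Matrix (Fin l → Fin d) (Fin l → Fin d) ℂ :=
  tensor (fun i => N (J i)) * coordProj {y | (fun i => (J i, y i)) ∈ S}
    * (tensor fun i => N (J i))ᴴ

variable (N : γ → Matrix (Fin d) (Fin d) ℂ) (S : Finset (Fin l → γ × Fin d)) (J : Fin l → γ)

lemma posSemidef_cut : (cut N S J).PosSemidef :=
  (nonneg_iff_posSemidef.1 (isStarProjection_coordProj _).nonneg).mul_mul_conjTranspose_same _

lemma cut_compl [Fintype γ] :
    cut N Sᶜ J = tensor (fun i => N (J i) * (N (J i))ᴴ) - cut N S J := by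
  have h_compl : coordProj {y : Fin l → Fin d | (fun i => (J i, y i)) ∈ Sᶜ}
      = 1 - coordProj {y : Fin l → Fin d | (fun i => (J i, y i)) ∈ S} := by
    rw [one_sub_coordProj, Finset.compl_filter]
    simp only [Finset.mem_compl]
  rw [cut, cut, h_compl, mul_sub, sub_mul, mul_one, conjTranspose_tensor, tensor_mul]

lemma cut_le : cut N S J ≤ tensor fun i => N (J i) * (N (J i))ᴴ := by
  have h_mul : (tensor fun i => N (J i) * (N (J i))ᴴ)
      = (tensor fun i => N (J i)) * 1 * (tensor fun i => N (J i))ᴴ := by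
    rw [mul_one, conjTranspose_tensor, tensor_mul]
  rw [h_mul]
  exact mul_mul_conjTranspose_le (isStarProjection_coordProj _).le_one _

variable {ρ F : Matrix (Fin d) (Fin d) ℂ}

lemma expect_tensorWith_cut (hρ : ρ.PosSemidef) (hF : F.PosSemidef) (k : Fin l) :
    expect (tensorWith ρ k F) (cut N S J)
      = ∑ y : Fin l → Fin d with (fun i => (J i, y i)) ∈ S,
        wordProb (letterWeight N ρ) k (letterWeight N F) fun i => (J i, y i) := by
  rw [cut, expect_conj, expect_coordProj, conjTranspose_tensor, tensorWith, tensor_mul,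
    tensor_mul]
  refine Finset.sum_congr rfl fun y _ => ?_
  rw [tensor, of_apply, wordProb, ← Complex.ofReal_re (∏ i, _), Complex.ofReal_prod]
  congr 1
  refine Finset.prod_congr rfl fun i _ => ?_
  obtain rfl | hi := eq_or_ne i k
  · simp only [Function.update_self, ofReal_letterWeight N hF]
  · simp only [Function.update_of_ne hi, ofReal_letterWeight N hρ]

lemma sum_expect_tensorWith_cut [Fintype γ] (hρ : ρ.PosSemidef) (hF : F.PosSemidef) (k : Fin l) :
    ∑ J, expect (tensorWith ρ k F) (cut N S J)
      = ∑ x ∈ S, wordProb (letterWeight N ρ) k (letterWeight N F) x := by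
  simp only [expect_tensorWith_cut N S _ hρ hF, Finset.sum_filter]
  rw [← Fintype.sum_prod_type', ← Equiv.sum_comp (Equiv.arrowProdEquivProdArrow _ _ _)]
  exact (Finset.sum_ite_mem _ _ _).trans (by rw [Finset.univ_inter]; rfl)

end Cut

section TypicalWords

variable {l d : ℕ} {γ : Type} [Fintype γ] [DecidableEq γ] {ρ F : Matrix (Fin d) (Fin d) ℂ}
  {a N : γ → Matrix (Fin d) (Fin d) ℂ} {s : γ → Fin d → ℝ}

lemma IsDiagonalFactorization.sum_expect_cut_compl_le (h : IsDiagonalFactorization ρ a N s)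
    (hρ : ρ.PosSemidef) (hρ1 : ρ.trace = 1) (ha : IsPOVM a) (hF : F.PosSemidef)
    (hF1 : F.trace = 1) (k : Fin l) {θ : ℝ} (hθ : 0 < θ) (S : Finset (Fin l → γ × Fin d))
    (hS : ∀ x ∉ S, θ * √l ≤ |∑ i ∈ Finset.univ.erase k, (infoDensity ρ a s (x i)
      - ∑ j, homEntropy (cfc Real.sqrt ρ * a j * cfc Real.sqrt ρ))|) :
    ∑ J, expect (tensorWith ρ k F) (cut N Sᶜ J) ≤ 4 * d / θ ^ 2 := by
  have hN : ∑ j, N j * (N j)ᴴ = 1 := by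
    rw [← ha.sum_eq_one]
    exact Finset.sum_congr rfl fun j _ => (h.eq_mul_conjTranspose j).symm
  have h_weight (c : γ × Fin d) : letterWeight N ρ c = s c.1 c.2 := h.re_conj_apply c.1 c.2
  rw [sum_expect_tensorWith_cut N Sᶜ hρ hF]
  refine sum_wordProb_le_div_sq (letterWeight_nonneg N hρ) (letterWeight_nonneg N hF)
    (by rw [sum_letterWeight hN, hρ1, Complex.one_re])
    (by rw [sum_letterWeight hN, hF1, Complex.one_re]) k (infoDensity ρ a s) hθ ?_ _ ?_
  · simpa only [h_weight, Fintype.card_fin] using h.sum_mul_infoDensity_sq_le hρ hρ1 ha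
  · simpa only [h_weight, h.sum_mul_infoDensity, Finset.mem_compl, Fintype.card_fin] using hS

end TypicalWords

section TypicalWords

variable {l d : ℕ} {γ : Type} {ρ : Matrix (Fin d) (Fin d) ℂ} {a N : γ → Matrix (Fin d) (Fin d) ℂ}
  {s : γ → Fin d → ℝ}

lemma sum_infoDensity_eq_log_sub_log {x : Fin l → γ × Fin d}
    (h_prob : ∀ i, outcomeProb ρ a (x i).1 ≠ 0) (hs : ∀ i, s (x i).1 (x i).2 ≠ 0) :
    ∑ i, infoDensity ρ a s (x i)
      = Real.log (∏ i, outcomeProb ρ a (x i).1) - Real.log (∏ i, s (x i).1 (x i).2) := by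
  rw [Real.log_prod fun i _ => h_prob i, Real.log_prod fun i _ => hs i, ← Finset.sum_sub_distrib]
  rfl

lemma IsDiagonalFactorization.le_abs_sum_infoDensity_of_lt_prod
    (h : IsDiagonalFactorization ρ a N s) (hρ : ρ.PosSemidef) (μ b : ℝ)
    {x : Fin l → γ × Fin d} (k : Fin l)
    (hx : Real.exp (-(l * μ) + μ + b) * ∏ i, outcomeProb ρ a (x i).1
      < ∏ i, s (x i).1 (x i).2) :
    b ≤ |∑ i ∈ Finset.univ.erase k, (infoDensity ρ a s (x i) - μ)| := by
  have h_pos : 0 < ∏ i, s (x i).1 (x i).2 := by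
    refine hx.trans_le' (mul_nonneg (Real.exp_pos _).le (Finset.prod_nonneg fun i _ => ?_))
    exact (h.nonneg hρ _ (x i).2).trans (h.le_outcomeProb hρ _ _)
  have hs (i : Fin l) : 0 < s (x i).1 (x i).2 := (h.nonneg hρ _ _).lt_of_ne' fun h0 =>
    h_pos.ne' (Finset.prod_eq_zero (Finset.mem_univ i) h0)
  have h_prob (i : Fin l) : 0 < outcomeProb ρ a (x i).1 := (hs i).trans_le (h.le_outcomeProb hρ _ _)
  have h_log := Real.log_lt_log (mul_pos (Real.exp_pos _) (Finset.prod_pos fun i _ => h_prob i)) hx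
  rw [Real.log_mul (Real.exp_pos _).ne' (Finset.prod_pos fun i _ => h_prob i).ne', Real.log_exp]
    at h_log
  have h_sum := sum_infoDensity_eq_log_sub_log (fun i => (h_prob i).ne') fun i => (hs i).ne'
  have h_letter := h.infoDensity_nonneg hρ (hs k)
  rw [Finset.sum_erase_eq_sub (Finset.mem_univ k), Finset.sum_sub_distrib, h_sum,
    Finset.sum_const, Finset.card_univ, Fintype.card_fin, nsmul_eq_mul]
  refine le_abs.2 (.inr ?_)
  linarith

lemma le_abs_sum_infoDensity_of_prod_lt {μ : ℝ} (hμ : 0 ≤ μ) (b : ℝ) {c : ℝ} (hc0 : 0 < c)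
    (hc : ∀ j y, c * outcomeProb ρ a j ≤ s j y)
    (h_prob : ∀ j, 0 < outcomeProb ρ a j) {x : Fin l → γ × Fin d} (k : Fin l)
    (hx : Real.exp (l * μ + b + Real.log c⁻¹) * ∏ i, s (x i).1 (x i).2
      < ∏ i, outcomeProb ρ a (x i).1) :
    b ≤ |∑ i ∈ Finset.univ.erase k, (infoDensity ρ a s (x i) - μ)| := by
  have hs (j : γ) (y : Fin d) : 0 < s j y := (mul_pos hc0 (h_prob j)).trans_le (hc j y)
  have h_log := Real.log_lt_log (mul_pos (Real.exp_pos _) (Finset.prod_pos fun i _ => hs _ _)) hx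
  rw [Real.log_mul (Real.exp_pos _).ne' (Finset.prod_pos fun i _ => hs _ _).ne', Real.log_exp]
    at h_log
  have h_sum := sum_infoDensity_eq_log_sub_log (fun i => (h_prob (x i).1).ne')
    fun i => (hs (x i).1 (x i).2).ne'
  have h_letter : infoDensity ρ a s (x k) ≤ Real.log c⁻¹ := by
    have h_le := Real.log_le_log (mul_pos hc0 (h_prob _)) (hc (x k).1 (x k).2)
    rw [Real.log_mul hc0.ne' (h_prob _).ne'] at h_le
    rw [infoDensity, Real.log_inv]
    linarith
  rw [Finset.sum_erase_eq_sub (Finset.mem_univ k), Finset.sum_sub_distrib, h_sum,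
    Finset.sum_const, Finset.card_univ, Fintype.card_fin, nsmul_eq_mul]
  refine le_abs.2 (.inl ?_)
  linarith

lemma IsDiagonalFactorization.conjTranspose_tensor_mul_mul (h : IsDiagonalFactorization ρ a N s)
    (J : Fin l → γ) :
    (tensor fun i => N (J i))ᴴ * tensor (fun _ => ρ) * (tensor fun i => N (J i))
      = diagonal fun y => ((∏ i, s (J i) (y i) : ℝ) : ℂ) := by
  simp only [conjTranspose_tensor, tensor_mul, h.conj_eq_diagonal, tensor_diagonal,
    Complex.ofReal_prod]

end TypicalWords

section TypicalProjection

variable {l d : ℕ} {ρ : Matrix (Fin d) (Fin d) ℂ}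

lemma isPOVM_one {ι n : Type} [Unique ι] [Fintype n] [DecidableEq n] :
    IsPOVM fun _ : ι => (1 : Matrix n n ℂ) where
  posSemidef _ := PosSemidef.one
  sum_eq_one := by simp

lemma isStarProjection_mul_mul_conjTranspose {n : Type*} [Fintype n] [DecidableEq n]
    {U E : Matrix n n ℂ} (hU : Uᴴ * U = 1) (hE : IsStarProjection E) :
    IsStarProjection (U * E * Uᴴ) where
  isIdempotentElem := by
    rw [IsIdempotentElem, mul_assoc (U * E), ← mul_assoc Uᴴ, ← mul_assoc Uᴴ, hU, one_mul,
      ← mul_assoc, mul_assoc U, hE.isIdempotentElem]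
  isSelfAdjoint := isHermitian_mul_mul_conjTranspose U hE.isSelfAdjoint

lemma IsDiagonalFactorization.cut_le_smul_tensor {γ : Type} [DecidableEq γ]
    {a N : γ → Matrix (Fin d) (Fin d) ℂ} {s : γ → Fin d → ℝ}
    (h : IsDiagonalFactorization ρ a N s) (hρ : ρ.PosSemidef) {J : Fin l → γ}
    (hN : ∀ i, N (J i) * (N (J i))ᴴ = 1) (S : Finset (Fin l → γ × Fin d)) {b : ℝ} (hb : 0 ≤ b)
    (hS : ∀ x ∈ S, 1 ≤ b * ∏ i, s (x i).1 (x i).2) :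
    cut N S J ≤ b • tensor fun _ => ρ := by
  set U : Matrix (Fin l → Fin d) (Fin l → Fin d) ℂ := tensor fun i => N (J i) with hU
  have hUU : U * Uᴴ = 1 := by simp only [hU, conjTranspose_tensor, tensor_mul, hN, tensor_one]
  have h_diag : (diagonal fun y => ((b * ∏ i, s (J i) (y i) : ℝ) : ℂ))
      = b • (Uᴴ * tensor (fun _ => ρ) * U) := by
    rw [h.conjTranspose_tensor_mul_mul, ← diagonal_smul]
    simp [Pi.smul_def]
  have h_conj := mul_mul_conjTranspose_le (coordProj_le_diagonal
    {y : Fin l → Fin d | (fun i => (J i, y i)) ∈ S}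
    (fun y => mul_nonneg hb (Finset.prod_nonneg fun i _ => h.nonneg hρ (J i) (y i)))
    fun y hy => hS _ (by simpa using hy)) U
  refine h_conj.trans_eq ?_
  rw [h_diag, mul_smul_comm, smul_mul_assoc, mul_assoc, mul_assoc, hUU, mul_one, ← mul_assoc,
    hUU, one_mul]

lemma IsDiagonalFactorization.le_of_smul_one_le {n γ : Type} [Fintype n] [DecidableEq n]
    {ρ : Matrix n n ℂ} {a N : γ → Matrix n n ℂ} {s : γ → n → ℝ}
    (h : IsDiagonalFactorization ρ a N s) {j : γ} (hN : (N j)ᴴ * N j = 1) {c : ℝ}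
    (hc : c • 1 ≤ ρ) (y : n) : c ≤ s j y := by
  have h_conj := conjTranspose_mul_mul_le hc (N j)
  rw [mul_smul_comm, smul_mul_assoc, mul_one, hN, h.conj_eq_diagonal] at h_conj
  have h_entry := (Complex.le_def.1 ((le_iff.1 h_conj).diag_nonneg (i := y))).1
  simpa using h_entry

lemma exists_typicalProjection (hρ : ρ.PosSemidef) (hρ1 : ρ.trace = 1) {c : ℝ} (hc0 : 0 < c)
    (hc : c • 1 ≤ ρ) {θ : ℝ} (hθ : 0 < θ) (l : ℕ) :
    ∃ P : Matrix (Fin l → Fin d) (Fin l → Fin d) ℂ, IsStarProjection P ∧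
      P ≤ Real.exp (l * entropy ρ + θ * √l + Real.log c⁻¹) • tensor (fun _ => ρ) ∧
      ∀ (k : Fin l) (F : Matrix (Fin d) (Fin d) ℂ), F.PosSemidef → F.trace = 1 →
        expect (tensorWith ρ k F) (1 - P) ≤ 4 * d / θ ^ 2 := by
  obtain ⟨N, s, h⟩ := exists_isDiagonalFactorization (γ := Unit) hρ isPOVM_one
  have hN : N () * (N ())ᴴ = 1 := (h.eq_mul_conjTranspose ()).symm
  have hN' : (N ())ᴴ * N () = 1 := mul_eq_one_comm.1 hN
  have hU : (tensor fun _ : Fin l => N ())ᴴ * (tensor fun _ => N ()) = 1 := by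
    rw [conjTranspose_tensor, tensor_mul, hN', tensor_one]
  have h_prob (j : Unit) : outcomeProb ρ (fun _ => 1) j = 1 := by simp [outcomeProb, hρ1]
  have h_mean : homEntropy (cfc Real.sqrt ρ * 1 * cfc Real.sqrt ρ) = entropy ρ := by
    rw [mul_one, cfc_sqrt_mul_cfc_sqrt hρ, homEntropy_of_trace_eq_one hρ1]
  set Λ := l * entropy ρ + θ * √l + Real.log c⁻¹
  set S : Finset (Fin l → Unit × Fin d) := {x | 1 ≤ Real.exp Λ * ∏ i, s (x i).1 (x i).2}
  refine ⟨cut N S fun _ => (), isStarProjection_mul_mul_conjTranspose hU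
    (isStarProjection_coordProj _), h.cut_le_smul_tensor hρ (fun _ => hN) S (Real.exp_pos _).le
    (by simp [S]), fun k F hF hF1 => ?_⟩
  have h_tail := h.sum_expect_cut_compl_le hρ hρ1 isPOVM_one hF hF1 k hθ S fun x hx => by
    rw [Fintype.sum_unique, h_mean]
    refine le_abs_sum_infoDensity_of_prod_lt (entropy_nonneg hρ (by simp [hρ1])) _ hc0
      (fun j y => ?_) (by simp [h_prob]) k ?_
    · rw [h_prob, mul_one]
      exact h.le_of_smul_one_le hN' hc y
    · simpa [S, Λ, h_prob, -Real.log_inv] using hx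
  simp only [cut_compl, hN, tensor_one, Fintype.sum_unique] at h_tail
  exact h_tail

end TypicalProjection

section Resolution

variable {l d : ℕ} {γ : Type} {ρ : Matrix (Fin d) (Fin d) ℂ} {a N : γ → Matrix (Fin d) (Fin d) ℂ}
  {s : γ → Fin d → ℝ}

lemma inv_smul_mul_inv_smul_le {n : Type*} [Fintype n] {Y : Matrix n n ℂ} {B p : ℝ} (hp : 0 ≤ p)
    (hY : Y * Y ≤ (B * p) • Y) : (p⁻¹ • Y) * (p⁻¹ • Y) ≤ B • p⁻¹ • Y := by
  obtain rfl | hp' := hp.eq_or_lt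
  · simp
  · calc (p⁻¹ • Y) * (p⁻¹ • Y) = (p⁻¹ * p⁻¹) • (Y * Y) := smul_mul_smul_comm ..
      _ ≤ (p⁻¹ * p⁻¹) • (B * p) • Y := smul_le_smul_of_nonneg_left hY (by positivity)
      _ = B • p⁻¹ • Y := by
        rw [smul_smul, smul_smul]
        congr 1
        field_simp

lemma exp_mul_exp_le_exp_entropyDefect [Fintype γ] (hρ : ρ.PosSemidef) (hρ1 : ρ.trace = 1)
    (ha : IsPOVM a) (l : ℕ) (b r : ℝ) {μ : ℝ}
    (hμ : μ = ∑ j, homEntropy (cfc Real.sqrt ρ * a j * cfc Real.sqrt ρ)) :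
    Real.exp (l * entropy ρ + b + r) * Real.exp (-(l * μ) + μ + b)
      ≤ Real.exp (l * entropyDefect ρ a + 2 * b + d + r) := by
  have h_defect : entropyDefect ρ a = entropy ρ - μ := by
    simp only [entropyDefect, outcomeProb_mul_entropy_canonicalState hρ, hμ]
  have h_nonneg := entropyDefect_nonneg hρ hρ1 ha
  have h_entropy := entropy_le_card hρ
  rw [Fintype.card_fin] at h_entropy
  rw [← Real.exp_add, Real.exp_le_exp, h_defect]
  linarith

lemma posSemidef_projection_conj {n : Type*} [Fintype n] {P A : Matrix n n ℂ}
    (hP : IsStarProjection P) (hA : A.PosSemidef) : (P * A * P).PosSemidef := by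
  have h_conj := hA.mul_mul_conjTranspose_same P
  rwa [← star_eq_conjTranspose, hP.isSelfAdjoint] at h_conj

lemma tensor_eq_zero {F : Fin l → Matrix (Fin d) (Fin d) ℂ} {i : Fin l} (h : F i = 0) :
    tensor F = 0 := by
  ext x y
  exact Finset.prod_eq_zero (Finset.mem_univ i) (by rw [h, Matrix.zero_apply])

lemma eq_zero_of_outcomeProb_eq_zero {c : ℝ} (hc0 : 0 < c) (hc : c • 1 ≤ ρ) {j : γ}
    (ha : (a j).PosSemidef) (h : outcomeProb ρ a j = 0) : a j = 0 := by
  refine eq_zero_of_re_trace_eq_zero ha (le_antisymm ?_ (re_trace_nonneg ha))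
  have h_le : c * (a j).trace.re ≤ outcomeProb ρ a j := by
    have h_mono := expect_mono_left ha hc
    rwa [expect_smul_left, expect_comm, expect_one] at h_mono
  exact nonpos_of_mul_nonpos_right (h_le.trans_eq h) hc0

variable [DecidableEq γ]

lemma cut_eq_zero_of_prod_outcomeProb_eq_zero (h : IsDiagonalFactorization ρ a N s)
    {c : ℝ} (hc0 : 0 < c) (hc : c • 1 ≤ ρ) (S : Finset (Fin l → γ × Fin d)) {J : Fin l → γ}
    (hJ : ∏ i, outcomeProb ρ a (J i) = 0) : cut N S J = 0 := by
  obtain ⟨i, -, hi⟩ := Finset.prod_eq_zero_iff.1 hJ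
  have ha : (a (J i)).PosSemidef := by
    rw [h.eq_mul_conjTranspose]
    exact posSemidef_self_mul_conjTranspose _
  have h_zero := eq_zero_of_outcomeProb_eq_zero hc0 hc ha hi
  rw [h.eq_mul_conjTranspose] at h_zero
  have h_tensor : (tensor fun i => N (J i) * (N (J i))ᴴ) = 0 := tensor_eq_zero h_zero
  exact le_antisymm (h_tensor ▸ cut_le N S J) (posSemidef_cut N S J).nonneg

lemma IsDiagonalFactorization.projection_conj_cut_mul_self_le
    (h : IsDiagonalFactorization ρ a N s) {P : Matrix (Fin l → Fin d) (Fin l → Fin d) ℂ}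
    (hP : IsStarProjection P) {b : ℝ} (hb : 0 ≤ b) (hPρ : P ≤ b • tensor fun _ => ρ)
    (S : Finset (Fin l → γ × Fin d)) (J : Fin l → γ) {e : ℝ} (he : 0 ≤ e)
    (hS : ∀ x ∈ S, (∀ i, (x i).1 = J i) → ∏ i, s (x i).1 (x i).2 ≤ e) :
    (P * cut N S J * P) * (P * cut N S J * P) ≤ (b * e) • (P * cut N S J * P) := by
  set T : Matrix (Fin l → Fin d) (Fin l → Fin d) ℂ := tensor fun i => N (J i) with hT
  set E := coordProj {y : Fin l → Fin d | (fun i => (J i, y i)) ∈ S} with hE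
  have h_star : Pᴴ = P := hP.isSelfAdjoint
  have h_starE : Eᴴ = E := (isStarProjection_coordProj _).isSelfAdjoint
  have h_cut : P * cut N S J * P = (P * T * E) * (P * T * E)ᴴ := by
    simp only [conjTranspose_mul, h_star, h_starE, cut, ← hT, ← hE, mul_assoc]
    rw [← mul_assoc E E, (isStarProjection_coordProj _).isIdempotentElem]
  rw [h_cut]
  refine mul_conjTranspose_mul_self_le ?_
  calc (P * T * E)ᴴ * (P * T * E) = Eᴴ * (Tᴴ * P * T) * E := by
        simp only [conjTranspose_mul, h_star, mul_assoc]
        rw [← mul_assoc P P, hP.isIdempotentElem]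
    _ ≤ Eᴴ * (Tᴴ * (b • tensor fun _ => ρ) * T) * E :=
        conjTranspose_mul_mul_le (conjTranspose_mul_mul_le hPρ T) E
    _ = b • (E * diagonal (fun y => ((∏ i, s (J i) (y i) : ℝ) : ℂ)) * E) := by
        rw [mul_smul_comm, smul_mul_assoc, h.conjTranspose_tensor_mul_mul, mul_smul_comm,
          smul_mul_assoc, h_starE]
    _ ≤ b • e • 1 := smul_le_smul_of_nonneg_left (coordProj_mul_diagonal_mul_coordProj_le _ he
        fun y hy => hS _ (by simpa using hy) fun _ => rfl) hb
    _ = (b * e) • 1 := smul_smul _ _ _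

variable [Fintype γ]

lemma expect_tensorWith_sum_tensor (hρ1 : ρ.trace = 1) (ha : ∑ j, a j = 1) (k : Fin l) (j : γ)
    (F : Matrix (Fin d) (Fin d) ℂ) :
    expect (tensorWith ρ k F) (∑ J : Fin l → γ with J k = j, tensor fun i => a (J i))
      = expect F (a j) := by
  rw [sum_tensor_of_apply_eq, ha, expect_apply, tensorWith_mul_tensorWith, mul_one,
    trace_tensorWith hρ1, expect_apply]

lemma sum_cut_le_one (hN : ∑ j, N j * (N j)ᴴ = 1) (S : Finset (Fin l → γ × Fin d))
    (R : Finset (Fin l → γ)) : ∑ J ∈ R, cut N S J ≤ 1 := by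
  calc ∑ J ∈ R, cut N S J ≤ ∑ J, cut N S J := Finset.sum_le_univ_sum_of_nonneg fun J =>
        (posSemidef_cut N S J).nonneg
    _ ≤ ∑ J : Fin l → γ, tensor fun i => N (J i) * (N (J i))ᴴ :=
        Finset.sum_le_sum fun J _ => cut_le N S J
    _ = 1 := by
        rw [sum_tensor fun _ c => N c * (N c)ᴴ, hN, tensor_one]

lemma abs_expect_sum_cut_sub_le (hρ : ρ.PosSemidef) (hρ1 : ρ.trace = 1)
    (hN : ∑ j, N j * (N j)ᴴ = 1) {F : Matrix (Fin d) (Fin d) ℂ} (hF : F.PosSemidef)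
    (S : Finset (Fin l → γ × Fin d)) (k : Fin l) (j : γ) :
    |expect (tensorWith ρ k F) (∑ J with J k = j, cut N S J) - expect F (N j * (N j)ᴴ)|
      ≤ ∑ J, expect (tensorWith ρ k F) (cut N Sᶜ J) := by
  have hσ := posSemidef_tensorWith hρ hF k
  have h_nonneg (J : Fin l → γ) : 0 ≤ expect (tensorWith ρ k F) (cut N Sᶜ J) :=
    expect_nonneg hσ (posSemidef_cut N Sᶜ J)
  have h_sub : expect F (N j * (N j)ᴴ) - expect (tensorWith ρ k F) (∑ J with J k = j, cut N S J)
      = ∑ J : Fin l → γ with J k = j, expect (tensorWith ρ k F) (cut N Sᶜ J) := by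
    rw [← expect_tensorWith_sum_tensor hρ1 hN k j F, ← map_sub, ← Finset.sum_sub_distrib, map_sum]
    simp only [cut_compl]
  rw [abs_sub_comm, h_sub, abs_of_nonneg (Finset.sum_nonneg fun J _ => h_nonneg J)]
  exact Finset.sum_le_univ_sum_of_nonneg h_nonneg

lemma abs_expect_projection_conj_sum_cut_sub_le (hρ : ρ.PosSemidef) (hρ1 : ρ.trace = 1)
    (hN : ∑ j, N j * (N j)ᴴ = 1) {F : Matrix (Fin d) (Fin d) ℂ} (hF : F.PosSemidef)
    (hF1 : F.trace = 1) {P : Matrix (Fin l → Fin d) (Fin l → Fin d) ℂ} (hP : IsStarProjection P)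
    (S : Finset (Fin l → γ × Fin d)) (k : Fin l) (j : γ) {δ : ℝ}
    (hPδ : expect (tensorWith ρ k F) (1 - P) ≤ δ)
    (hSδ : ∑ J, expect (tensorWith ρ k F) (cut N Sᶜ J) ≤ δ) :
    |expect (tensorWith ρ k F) (P * (∑ J with J k = j, cut N S J) * P)
      - expect F (N j * (N j)ᴴ)| ≤ 2 * √δ + δ := by
  refine (abs_sub_le _ _ _).trans (add_le_add ?_
    ((abs_expect_sum_cut_sub_le hρ hρ1 hN hF S k j).trans hSδ))
  refine (abs_expect_projection_conj_sub_le (posSemidef_tensorWith hρ hF k)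
    (by rw [trace_tensorWith hρ1, hF1]) hP (posSemidef_sum _ fun J _ => posSemidef_cut N S J)
    (sum_cut_le_one hN S _)).trans ?_
  gcongr

lemma exists_typicalResolution (hρ : ρ.PosSemidef) (hρ1 : ρ.trace = 1) (ha : IsPOVM a) {c : ℝ}
    (hc0 : 0 < c) (hc : c • 1 ≤ ρ) {θ : ℝ} (hθ : 0 < θ) (l : ℕ) :
    ∃ X : (Fin l → γ) → Matrix (Fin l → Fin d) (Fin l → Fin d) ℂ,
      (∀ J, (X J).PosSemidef) ∧
      (∀ J, X J * X J ≤
        Real.exp (l * entropyDefect ρ a + 2 * θ * √l + d + Real.log c⁻¹) • X J) ∧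
      ∑ J, (∏ i, outcomeProb ρ a (J i)) • X J ≤ 1 ∧
      ∀ (k : Fin l) (j : γ) (F : Matrix (Fin d) (Fin d) ℂ), F.PosSemidef → F.trace = 1 →
        |expect (tensorWith ρ k F) (∑ J with J k = j, (∏ i, outcomeProb ρ a (J i)) • X J)
          - expect F (a j)| ≤ 2 * √(4 * d / θ ^ 2) + 4 * d / θ ^ 2 := by
  obtain ⟨N, s, h⟩ := exists_isDiagonalFactorization hρ ha
  have hN : ∑ j, N j * (N j)ᴴ = 1 := by simp only [← h.eq_mul_conjTranspose, ha.sum_eq_one]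
  obtain ⟨P, hP, hPρ, hPF⟩ := exists_typicalProjection hρ hρ1 hc0 hc hθ l
  set μ := ∑ j, homEntropy (cfc Real.sqrt ρ * a j * cfc Real.sqrt ρ) with hμ
  set S : Finset (Fin l → γ × Fin d) := {x | ∏ i, s (x i).1 (x i).2
    ≤ Real.exp (-(l * μ) + μ + θ * √l) * ∏ i, outcomeProb ρ a (x i).1}
  set p : (Fin l → γ) → ℝ := fun J => ∏ i, outcomeProb ρ a (J i) with hp
  have hp0 (J : Fin l → γ) : 0 ≤ p J := Finset.prod_nonneg fun i _ => outcomeProb_nonneg hρ ha _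
  have h_psd (J : Fin l → γ) := posSemidef_projection_conj hP (posSemidef_cut N S J)
  have h_smul (J : Fin l → γ) : p J • ((p J)⁻¹ • (P * cut N S J * P)) = P * cut N S J * P := by
    rw [smul_smul]
    obtain hJ | hJ := eq_or_ne (p J) 0
    · rw [cut_eq_zero_of_prod_outcomeProb_eq_zero h hc0 hc S hJ, mul_zero, zero_mul, smul_zero]
    · rw [mul_inv_cancel₀ hJ, one_smul]
  have h_sum (R : Finset (Fin l → γ)) :
      ∑ J ∈ R, p J • ((p J)⁻¹ • (P * cut N S J * P)) = P * (∑ J ∈ R, cut N S J) * P := by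
    simp only [h_smul, Matrix.mul_sum, Matrix.sum_mul]
  refine ⟨fun J => (p J)⁻¹ • (P * cut N S J * P), fun J => (h_psd J).smul (inv_nonneg.2 (hp0 J)),
    fun J => ?_, ?_, fun k j F hF hF1 => ?_⟩
  · have h_sq := h.projection_conj_cut_mul_self_le hP (Real.exp_pos _).le hPρ S J
      (e := Real.exp (-(l * μ) + μ + θ * √l) * p J) (mul_nonneg (Real.exp_pos _).le (hp0 J))
      fun x hx hxJ => by simpa [S, hp, hxJ] using hx
    refine inv_smul_mul_inv_smul_le (hp0 J)
      (h_sq.trans (smul_le_smul_of_nonneg_right ?_ (h_psd J).nonneg))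
    rw [← mul_assoc, mul_assoc 2]
    exact mul_le_mul_of_nonneg_right (exp_mul_exp_le_exp_entropyDefect hρ hρ1 ha l _ _ hμ) (hp0 J)
  · rw [h_sum]
    exact projection_conj_le_one hP (sum_cut_le_one hN S _)
  · rw [h_sum, h.eq_mul_conjTranspose]
    refine abs_expect_projection_conj_sum_cut_sub_le hρ hρ1 hN hF hF1 hP S k j (hPF k F hF hF1)
      (h.sum_expect_cut_compl_le hρ hρ1 ha hF hF1 k hθ S fun x hx => ?_)
    exact h.le_abs_sum_infoDensity_of_lt_prod hρ μ _ k (by simpa [S] using hx)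

end Resolution

section Expectation

variable {n : Type*} [Fintype n] [DecidableEq n] {σ σ' B : Matrix n n ℂ}

lemma expect_nonneg_le_one (hσ : σ.PosSemidef) (hσ1 : σ.trace = 1) (hB : B.PosSemidef)
    (hB1 : B ≤ 1) : 0 ≤ expect σ B ∧ expect σ B ≤ 1 :=
  ⟨expect_nonneg hσ hB, (expect_mono hσ hB1).trans_eq (by rw [expect_one, hσ1, Complex.one_re])⟩

lemma abs_expect_sub_le_of_smul_le (hσ : σ.PosSemidef) (hσ1 : σ.trace = 1) (hσ'1 : σ'.trace = 1)
    {c : ℝ} (hc : c ≤ 1) (h : c • σ ≤ σ') (hB : B.PosSemidef) (hB1 : B ≤ 1) :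
    |expect σ B - expect σ' B| ≤ 1 - c := by
  obtain ⟨h_nonneg, h_le_one⟩ := expect_nonneg_le_one hσ hσ1 hB hB1
  have h_lower := expect_mono_left hB h
  have h_upper := expect_mono_left (le_iff.1 hB1) h
  rw [expect_smul_left] at h_lower h_upper
  rw [map_sub, map_sub, expect_one, expect_one, hσ1, hσ'1, Complex.one_re] at h_upper
  have h_mul := mul_nonneg (sub_nonneg.2 hc) h_nonneg
  have h_mul' := mul_nonneg (sub_nonneg.2 hc) (sub_nonneg.2 h_le_one)
  rw [abs_le]
  constructor <;> linarith

end Expectation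

lemma le_one_of_trace_eq_one {n : Type} [Fintype n] [DecidableEq n] {F : Matrix n n ℂ}
    (hF : F.PosSemidef) (hF1 : F.trace = 1) : F ≤ 1 := by
  have hF' : IsSelfAdjoint F := hF.1
  rw [← cfc_id' ℝ F]
  refine cfc_le_one _ _ fun x hx => ?_
  rw [hF.1.spectrum_real_eq_range_eigenvalues] at hx
  obtain ⟨i, rfl⟩ := hx
  simpa [hF1] using eigenvalues_le_re_trace hF i

section Compression

variable {l d : ℕ} {ρ : Matrix (Fin d) (Fin d) ℂ}

lemma abs_expect_tensorWith_depolarize_sub_le [NeZero d] (hρ : ρ.PosSemidef) (hρ1 : ρ.trace = 1)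
    {F : Matrix (Fin d) (Fin d) ℂ} (hF : F.PosSemidef) (hF1 : F.trace = 1) {t : ℝ} (ht0 : 0 ≤ t)
    (ht1 : t ≤ 1) (k : Fin l) {B : Matrix (Fin l → Fin d) (Fin l → Fin d) ℂ} (hB : B.PosSemidef)
    (hB1 : B ≤ 1) :
    |expect (tensorWith ρ k F) B - expect (tensorWith (depolarize t ρ) k F) B| ≤ l * t := by
  have h_smul := pow_smul_tensorWith_le hρ hF (sub_nonneg.2 ht1) (sub_le_self 1 ht0)
    (smul_le_depolarize ht0 ρ) k
  refine (abs_expect_sub_le_of_smul_le (posSemidef_tensorWith hρ hF k)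
    ((trace_tensorWith hρ1 k).trans hF1) ((trace_tensorWith (trace_depolarize hρ1 t) k).trans hF1)
    (pow_le_one₀ (sub_nonneg.2 ht1) (sub_le_self 1 ht0)) h_smul hB hB1).trans ?_
  have h_bernoulli := one_add_mul_le_pow (a := -t) (by linarith) l
  rw [← sub_eq_add_neg] at h_bernoulli
  linarith

variable {γ : Type} [Fintype γ] [DecidableEq γ] {a : γ → Matrix (Fin d) (Fin d) ℂ}

lemma exists_compressed_tensorWith (hρ : ρ.PosSemidef) (hρ1 : ρ.trace = 1) (ha : IsPOVM a) {c : ℝ}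
    (hc0 : 0 < c) (hc : c • 1 ≤ ρ) {θ : ℝ} (hθ : 0 < θ) {δ : ℝ} (hδ : δ ≤ 1) {M : ℕ} (hM : 0 < M)
    (hlM : 2 * (l * Fintype.card γ) *
      (Real.exp (l * entropyDefect ρ a + 2 * θ * √l + d + Real.log c⁻¹) * d) ≤ δ * M) :
    ∃ (w : Fin M → Fin l → γ) (A : Fin M → Matrix (Fin l → Fin d) (Fin l → Fin d) ℂ),
      (∀ μ, (A μ).PosSemidef) ∧ ∑ μ, A μ ≤ 1 ∧
      ∀ (k : Fin l) (j : γ) (F : Matrix (Fin d) (Fin d) ℂ), F.PosSemidef → F.trace = 1 →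
        |expect (tensorWith ρ k F) (∑ μ with w μ k = j, A μ) - expect F (a j)|
          ≤ 4 * √δ + (2 * √(4 * d / θ ^ 2) + 4 * d / θ ^ 2) := by
  obtain ⟨X, hX, hXB, hX1, hXF⟩ := exists_typicalResolution hρ hρ1 ha hc0 hc hθ l
  have hp1 : ∑ J : Fin l → γ, ∏ i, outcomeProb ρ a (J i) = 1 := by
    rw [← Fintype.prod_sum fun _ j => outcomeProb ρ a j, sum_outcomeProb hρ1 ha,
      Finset.prod_const_one]
  obtain ⟨w, A, hA, hA1, hAw⟩ := exists_compressed (K := Fin l × γ)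
    (fun J => Finset.prod_nonneg fun i _ => outcomeProb_nonneg hρ ha (J i)) hp1 hX
    (Real.exp_pos _).le hXB hX1 (ω := fun κ => tensorWith ρ κ.1 1)
    (fun κ => posSemidef_tensorWith hρ PosSemidef.one κ.1) (τ := d)
    (fun κ => by simp [trace_tensorWith hρ1]) (fun κ => {J | J κ.1 = κ.2}) hδ hM
    (by simpa using hlM)
  refine ⟨w, A, hA, hA1, fun k j F hF hF1 => ?_⟩
  have h_le : tensorWith ρ k F ≤ tensorWith ρ k 1 :=
    tensorWith_mono hρ hF (le_one_of_trace_eq_one hF hF1) k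
  have h_compressed := hAw (k, j) (tensorWith ρ k F) (posSemidef_tensorWith hρ hF k)
    ((trace_tensorWith hρ1 k).trans hF1) h_le
  simp only [Finset.mem_filter, Finset.mem_univ, true_and] at h_compressed
  exact (abs_sub_le _ _ _).trans (add_le_add h_compressed (hXF k j F hF hF1))

lemma exists_compressed_tensorWith_of_posSemidef [NeZero d] (hρ : ρ.PosSemidef)
    (hρ1 : ρ.trace = 1) (ha : IsPOVM a) {t : ℝ} (ht0 : 0 < t) (ht1 : t ≤ 1) {θ : ℝ} (hθ : 0 < θ)
    {δ : ℝ} (hδ : δ ≤ 1) {M : ℕ} (hM : 0 < M)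
    (hlM : 2 * (l * Fintype.card γ) * (Real.exp (l * entropyDefect (depolarize t ρ) a
      + 2 * θ * √l + d + Real.log (d / t)) * d) ≤ δ * M) :
    ∃ (w : Fin M → Fin l → γ) (A : Fin M → Matrix (Fin l → Fin d) (Fin l → Fin d) ℂ),
      (∀ μ, (A μ).PosSemidef) ∧ ∑ μ, A μ ≤ 1 ∧
      ∀ (k : Fin l) (j : γ) (F : Matrix (Fin d) (Fin d) ℂ), F.PosSemidef → F.trace = 1 →
        |expect (tensorWith ρ k F) (∑ μ with w μ k = j, A μ) - expect F (a j)|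
          ≤ l * t + (4 * √δ + (2 * √(4 * d / θ ^ 2) + 4 * d / θ ^ 2)) := by
  have hd : (0 : ℝ) < d := by exact_mod_cast NeZero.pos d
  have hc : (t / d) • 1 ≤ depolarize t ρ := by
    simpa only [Fintype.card_fin] using smul_one_le_depolarize hρ ht1
  obtain ⟨w, A, hA, hA1, hAw⟩ := exists_compressed_tensorWith
    (posSemidef_depolarize hρ ht0.le ht1) (trace_depolarize hρ1 t) ha (div_pos ht0 hd) hc hθ hδ hM
    (by rwa [inv_div])
  refine ⟨w, A, hA, hA1, fun k j F hF hF1 => (abs_sub_le _ _ _).trans (add_le_add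
    (abs_expect_tensorWith_depolarize_sub_le hρ hρ1 hF hF1 ht0.le ht1 k
      (posSemidef_sum _ fun μ _ => hA μ) ?_) (hAw k j F hF hF1))⟩
  exact (Finset.sum_le_univ_sum_of_nonneg fun μ => (hA μ).nonneg).trans hA1

end Compression

section Marginal

variable {l d m M : ℕ} {ρ : Matrix (Fin d) (Fin d) ℂ}
  {A : Fin M → Matrix (Fin l → Fin d) (Fin l → Fin d) ℂ} {w : Fin M → Fin l → Fin m}

lemma trace_vecMulVec_star {n : Type*} [Fintype n] {v : n → ℂ} (hv : star v ⬝ᵥ v = 1) :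
    (vecMulVec v (star v)).trace = 1 := by
  rw [trace_vecMulVec, dotProduct_comm, hv]

lemma dotProduct_mulVec_eq_trace {n : Type*} [Fintype n] (v : n → ℂ) (X : Matrix n n ℂ) :
    star v ⬝ᵥ X *ᵥ v = (X * vecMulVec v (star v)).trace := by
  rw [mul_vecMulVec, trace_vecMulVec, dotProduct_comm]

lemma im_trace_mul_eq_zero {n : Type*} [Fintype n] {ω B : Matrix n n ℂ} (hω : ω.PosSemidef)
    (hB : B.PosSemidef) : (ω * B).trace.im = 0 :=
  (Complex.le_def.1 (trace_mul_nonneg hω hB)).2.symm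

lemma opNorm_marginal_sub_le (hρ : ρ.PosSemidef) (hA : ∀ μ, (A μ).PosSemidef) {k : Fin l}
    {j : Fin m} {b : Matrix (Fin d) (Fin d) ℂ} (hb : b.PosSemidef) {δ : ℝ} (hδ : 0 ≤ δ)
    (h : ∀ F : Matrix (Fin d) (Fin d) ℂ, F.PosSemidef → F.trace = 1 →
      |expect (tensorWith ρ k F) (∑ μ with w μ k = j, A μ) - expect F b| ≤ δ) :
    opNorm (marginal ρ A w k j - b) ≤ δ := by
  have h_quad (v : Fin d → ℂ) : star v ⬝ᵥ (marginal ρ A w k j - b) *ᵥ v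
      = (tensorWith ρ k (vecMulVec v (star v)) * ∑ μ with w μ k = j, A μ).trace
        - (vecMulVec v (star v) * b).trace := by
    rw [dotProduct_mulVec_eq_trace, sub_mul, trace_sub, marginal,
      trace_partialTraceExcept_tensorWith_mul, trace_mul_comm b]
  have h_psd (v : Fin d → ℂ) := posSemidef_vecMulVec_self_star v
  refine opNorm_le_of_isHermitian (isHermitian_of_forall_im_dotProduct_eq_zero fun v => ?_) hδ
    fun v hv => ?_
  · rw [h_quad, Complex.sub_im, im_trace_mul_eq_zero (h_psd v) hb, im_trace_mul_eq_zero
      (posSemidef_tensorWith hρ (h_psd v) k) (posSemidef_sum _ fun μ _ => hA μ), sub_zero]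
  · rw [h_quad, Complex.sub_re]
    exact h _ (h_psd v) (trace_vecMulVec_star hv)

lemma isPOVM_snoc {n : Type} [Fintype n] [DecidableEq n] {A : Fin M → Matrix n n ℂ}
    (hA : ∀ μ, (A μ).PosSemidef) (hA1 : ∑ μ, A μ ≤ 1) :
    IsPOVM (Fin.snoc A (1 - ∑ μ, A μ) : Fin (M + 1) → Matrix n n ℂ) where
  posSemidef := Fin.lastCases (by rwa [Fin.snoc_last]) fun μ => by
    rw [Fin.snoc_castSucc]
    exact hA μ
  sum_eq_one := by simp [Fin.sum_univ_castSucc]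

variable {a : Fin m → Matrix (Fin d) (Fin d) ℂ}

lemma abs_expect_one_sub_sum_le (hρ1 : ρ.trace = 1) (ha : IsPOVM a) {η : ℝ} {k : Fin l}
    {F : Matrix (Fin d) (Fin d) ℂ}
    (h : ∀ j, |expect (tensorWith ρ k F) (∑ μ with w μ k = j, A μ) - expect F (a j)| ≤ η) :
    |expect (tensorWith ρ k F) (1 - ∑ μ, A μ)| ≤ m * η := by
  have h_one : expect (tensorWith ρ k F) 1 = ∑ j, expect F (a j) := by
    rw [← map_sum, ha.sum_eq_one, expect_one, expect_one, trace_tensorWith hρ1]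
  have h_fiber : ∑ μ, A μ = ∑ j, ∑ μ with w μ k = j, A μ := (Finset.sum_fiberwise ..).symm
  rw [map_sub, h_one, h_fiber, map_sum, ← Finset.sum_sub_distrib]
  calc |∑ j, (expect F (a j) - expect (tensorWith ρ k F) (∑ μ with w μ k = j, A μ))|
      ≤ ∑ j, |expect F (a j) - expect (tensorWith ρ k F) (∑ μ with w μ k = j, A μ)| :=
        Finset.abs_sum_le_sum_abs _ _
    _ ≤ ∑ _j : Fin m, η := Finset.sum_le_sum fun j _ => abs_sub_comm (expect F (a j)) _ ▸ h j
    _ = m * η := by simp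

lemma exists_isPOVM_sum_opNorm_marginal_sub_le [NeZero m] (hρ : ρ.PosSemidef) (hρ1 : ρ.trace = 1)
    (ha : IsPOVM a) (hA : ∀ μ, (A μ).PosSemidef) (hA1 : ∑ μ, A μ ≤ 1) {η : ℝ} (hη : 0 ≤ η)
    (h : ∀ (k : Fin l) (j : Fin m) (F : Matrix (Fin d) (Fin d) ℂ), F.PosSemidef → F.trace = 1 →
      |expect (tensorWith ρ k F) (∑ μ with w μ k = j, A μ) - expect F (a j)| ≤ η) :
    ∃ (A' : Fin (M + 1) → Matrix (Fin l → Fin d) (Fin l → Fin d) ℂ)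
      (w' : Fin (M + 1) → Fin l → Fin m), IsPOVM A' ∧
      ∀ k : Fin l, ∑ j, opNorm (marginal ρ A' w' k j - a j) ≤ 2 * m * η := by
  set A' : Fin (M + 1) → Matrix (Fin l → Fin d) (Fin l → Fin d) ℂ := Fin.snoc A (1 - ∑ μ, A μ)
  set w' : Fin (M + 1) → Fin l → Fin m := Fin.snoc w 0
  have hA' : IsPOVM A' := isPOVM_snoc hA hA1
  have h_sum (k : Fin l) (j : Fin m) : ∑ μ with w' μ k = j, A' μ
      = ∑ μ with w μ k = j, A μ + if 0 = j then 1 - ∑ μ, A μ else 0 := by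
    simp [Finset.sum_filter, Fin.sum_univ_castSucc, A', w']
  have h_norm (k : Fin l) (j : Fin m) :
      opNorm (marginal ρ A' w' k j - a j) ≤ η + if 0 = j then m * η else 0 := by
    refine opNorm_marginal_sub_le hρ hA'.posSemidef (ha.posSemidef j) (by positivity)
      fun F hF hF1 => ?_
    rw [h_sum, map_add, add_sub_right_comm]
    refine (abs_add_le _ _).trans (add_le_add (h k j F hF hF1) ?_)
    split_ifs
    · exact abs_expect_one_sub_sum_le hρ1 ha fun j => h k j F hF hF1
    · rw [map_zero, abs_zero]
  refine ⟨A', w', hA', fun k => (Finset.sum_le_sum fun j _ => h_norm k j).trans_eq ?_⟩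
  rw [Finset.sum_add_distrib, Finset.sum_ite_eq, Finset.sum_const, Finset.card_univ,
    Fintype.card_fin, nsmul_eq_mul, if_pos (Finset.mem_univ _)]
  ring

end Marginal

section Constants

lemma natCast_le_exp_two_mul_sqrt (l : ℕ) : (l : ℝ) ≤ Real.exp (2 * √l) := by
  calc (l : ℝ) = √l ^ 2 := (Real.sq_sqrt l.cast_nonneg).symm
    _ ≤ Real.exp √l ^ 2 :=
      pow_le_pow_left₀ (Real.sqrt_nonneg _) ((lt_add_one _).le.trans (Real.add_one_le_exp _)) 2
    _ = Real.exp (2 * √l) := by rw [← Real.exp_nat_mul, Nat.cast_ofNat]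

lemma exists_pos_le_one_add_sqrt_le (d : ℕ) {η : ℝ} (hη : 0 < η) :
    ∃ s : ℝ, 0 < s ∧ s ≤ 1 ∧
      s + (4 * √s + (2 * √(4 * d / s⁻¹ ^ 2) + 4 * d / s⁻¹ ^ 2)) ≤ η := by
  set f : ℝ → ℝ := fun s => s + (4 * √s + (2 * √(4 * d * s ^ 2) + 4 * d * s ^ 2)) with hf
  have h_cont : Continuous f := by fun_prop
  have h_lt : ∀ᶠ s in nhdsWithin 0 (Set.Ioi 0), f s < η :=
    (h_cont.continuousWithinAt.eventually_lt_const (by simpa [hf] using hη))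
  obtain ⟨s, hs, hs0, hs1⟩ := (h_lt.and (Ioc_mem_nhdsGT one_pos)).exists
  exact ⟨s, hs0, hs1, by simpa [hf, div_eq_mul_inv] using hs.le⟩

lemma exists_sampleSize {l : ℕ} (hl : 0 < l) (d m : ℕ) {δ b C E : ℝ} (hδ : 0 < δ) (hb : 0 ≤ b)
    (hC : 0 ≤ C) (hE : E ≤ b + C * √l) :
    ∃ M : ℕ, 0 < M ∧ 2 * (l * m) * (Real.exp E * d) ≤ δ * M ∧
      (M : ℝ) + 1 ≤ Real.exp (b + (C + 2 + Real.log (2 * m * d / δ + 3)) * √l) := by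
  have hl1 : (1 : ℝ) ≤ l := by exact_mod_cast hl
  set B := Real.exp (b + C * √l) with hB
  set K := 2 * m * d / δ + 3 with hK
  set Q := 2 * (l * m) * (B * d) / δ with hQ
  have hK1 : 1 ≤ K := by
    have : 0 ≤ 2 * m * d / δ := by positivity
    linarith
  have h_ceil : (⌈Q⌉₊ : ℝ) < Q + 1 := Nat.ceil_lt_add_one (by positivity)
  refine ⟨⌈Q⌉₊ + 1, Nat.succ_pos _, ?_, ?_⟩
  · calc 2 * (l * m) * (Real.exp E * d)
      _ ≤ 2 * (l * m) * (B * d) := by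
        gcongr
        exact Real.exp_le_exp.2 hE
      _ = δ * Q := (mul_div_cancel₀ _ hδ.ne').symm
      _ ≤ δ * (⌈Q⌉₊ + 1 : ℕ) := by
        gcongr
        push_cast
        linarith [Nat.le_ceil Q]
  have h_lB : 1 ≤ l * B := one_le_mul_of_one_le_of_one_le hl1 (Real.one_le_exp (by positivity))
  have h_K : K ≤ Real.exp (Real.log K * √l) := by
    calc K = Real.exp (Real.log K) := (Real.exp_log (by linarith)).symm
      _ ≤ Real.exp (Real.log K * √l) := Real.exp_le_exp.2
        (le_mul_of_one_le_right (Real.log_nonneg hK1) (Real.one_le_sqrt.2 hl1))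
  calc ((⌈Q⌉₊ + 1 : ℕ) : ℝ) + 1 ≤ Q + 3 * (l * B) := by push_cast; linarith
    _ = l * B * K := by rw [hQ, hK]; ring
    _ ≤ Real.exp (2 * √l) * B * Real.exp (Real.log K * √l) := by
      gcongr
      exact natCast_le_exp_two_mul_sqrt l
    _ = Real.exp (b + (C + 2 + Real.log K) * √l) := by
      rw [hB, ← Real.exp_add, ← Real.exp_add]
      congr 1
      ring

lemma log_div_div_le {l : ℕ} (hl : 0 < l) {x s : ℝ} (hx : 0 < x) (hs : 0 < s) :
    Real.log (x / (s / l)) ≤ x / s + 2 * √l := by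
  have hl0 : (0 : ℝ) < l := by exact_mod_cast hl
  rw [div_div_eq_mul_div, mul_div_right_comm, Real.log_mul (div_pos hx hs).ne' hl0.ne']
  exact add_le_add (Real.log_le_self (div_pos hx hs).le)
    ((Real.log_le_iff_le_exp hl0).2 (natCast_le_exp_two_mul_sqrt l))

lemma mul_entropyDefect_depolarize_le {d : ℕ} [NeZero d] {γ : Type} [Fintype γ] {l : ℕ} (hl : 0 < l)
    {ρ : Matrix (Fin d) (Fin d) ℂ} {a : γ → Matrix (Fin d) (Fin d) ℂ} (hρ : ρ.PosSemidef)
    (hρ1 : ρ.trace = 1) (ha : IsPOVM a) {s : ℝ} (hs0 : 0 < s) (hs1 : s ≤ 1) (θ : ℝ) :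
    l * entropyDefect (depolarize (s / l) ρ) a + 2 * θ * √l + d + Real.log (d / (s / l))
      ≤ l * entropyDefect ρ a + (2 * θ + 5 + 2 * d + 2 * (d / s)) * √l := by
  have hl1 : (1 : ℝ) ≤ l := by exact_mod_cast hl
  have hd1 : (1 : ℝ) ≤ d := by exact_mod_cast NeZero.one_le
  have ht0 : 0 < s / l := by positivity
  have ht1 : s / l ≤ 1 := div_le_one_of_le₀ (hs1.trans hl1) l.cast_nonneg
  have h_log := log_div_div_le hl (zero_lt_one.trans_le hd1) hs0
  have h_log_nonneg : 0 ≤ Real.log (d / (s / l)) :=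
    Real.log_nonneg ((one_le_div ht0).2 (ht1.trans hd1))
  have h_defect : l * entropyDefect (depolarize (s / l) ρ) a
      ≤ l * entropyDefect ρ a + s * (1 + Real.log (d / (s / l)) + d) := by
    have h := mul_le_mul_of_nonneg_left (entropyDefect_depolarize_le hρ hρ1 ha ht0.le ht1)
      l.cast_nonneg
    rw [Fintype.card_fin] at h
    refine h.trans_eq ?_
    field_simp
  have h_s : s * (1 + Real.log (d / (s / l)) + d) ≤ 1 + Real.log (d / (s / l)) + d :=
    mul_le_of_le_one_left (by positivity) hs1
  have h_const : 1 + 2 * d + 2 * (d / s) ≤ (1 + 2 * d + 2 * (d / s)) * √l :=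
    le_mul_of_one_le_right (by positivity) (Real.one_le_sqrt.2 hl1)
  linarith

lemma exists_compressed_card_le {d m l : ℕ} [NeZero d] (hl : 0 < l) {ρ : Matrix (Fin d) (Fin d) ℂ}
    {a : Fin m → Matrix (Fin d) (Fin d) ℂ} (hρ : ρ.PosSemidef) (hρ1 : ρ.trace = 1) (ha : IsPOVM a)
    {s : ℝ} (hs0 : 0 < s) (hs1 : s ≤ 1) :
    ∃ (M : ℕ) (w : Fin M → Fin l → Fin m) (A : Fin M → Matrix (Fin l → Fin d) (Fin l → Fin d) ℂ),
      (M : ℝ) + 1 ≤ Real.exp (l * entropyDefect ρ a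
        + (2 * s⁻¹ + 5 + 2 * d + 2 * (d / s) + 2 + Real.log (2 * m * d / s + 3)) * √l) ∧
      (∀ μ, (A μ).PosSemidef) ∧ ∑ μ, A μ ≤ 1 ∧
      ∀ (k : Fin l) (j : Fin m) (F : Matrix (Fin d) (Fin d) ℂ), F.PosSemidef → F.trace = 1 →
        |expect (tensorWith ρ k F) (∑ μ with w μ k = j, A μ) - expect F (a j)|
          ≤ s + (4 * √s + (2 * √(4 * d / s⁻¹ ^ 2) + 4 * d / s⁻¹ ^ 2)) := by
  have hl1 : (1 : ℝ) ≤ l := by exact_mod_cast hl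
  obtain ⟨M, hM, hlM, hM_le⟩ := exists_sampleSize hl d m hs0
    (mul_nonneg l.cast_nonneg (entropyDefect_nonneg hρ hρ1 ha)) (by positivity)
    (mul_entropyDefect_depolarize_le hl hρ hρ1 ha hs0 hs1 s⁻¹)
  obtain ⟨w, A, hA, hA1, hAw⟩ := exists_compressed_tensorWith_of_posSemidef (l := l) hρ hρ1 ha
    (t := s / l) (by positivity) (div_le_one_of_le₀ (hs1.trans hl1) l.cast_nonneg) (inv_pos.2 hs0)
    hs1 hM (by rwa [Fintype.card_fin])
  rw [mul_div_cancel₀ _ (by positivity)] at hAw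
  exact ⟨M, w, A, hM_le, hA, hA1, hAw⟩

end Constants

end POVMCompression

end

open POVMCompression in
theorem theorem2_general (d m : ℕ) (ε : ℝ) (hε : 0 < ε) :
    ∃ C : ℝ, ∀ (ρ : Matrix (Fin d) (Fin d) ℂ) (a : Fin m → Matrix (Fin d) (Fin d) ℂ),
      ρ.PosSemidef → ρ.trace = 1 → IsPOVM a → ∀ l : ℕ,
        ∃ (M : ℕ) (A : Fin M → Matrix (Fin l → Fin d) (Fin l → Fin d) ℂ)
          (w : Fin M → Fin l → Fin m),
          IsPOVM A ∧
          (M : ℝ) ≤ Real.exp (l * entropyDefect ρ a + C * √(l : ℝ)) ∧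
          ∀ k : Fin l, ∑ j, opNorm (marginal ρ A w k j - a j) ≤ ε := by
  obtain ⟨η, hη, hη_le⟩ : ∃ η : ℝ, 0 < η ∧ 2 * m * η ≤ ε :=
    ⟨ε / (2 * m + 1), by positivity, by
      rw [← mul_div_assoc, div_le_iff₀ (by positivity)]
      nlinarith⟩
  obtain ⟨s, hs0, hs1, hs⟩ := exists_pos_le_one_add_sqrt_le d hη
  refine ⟨2 * s⁻¹ + 5 + 2 * d + 2 * (d / s) + 2 + Real.log (2 * m * d / s + 3),
    fun ρ a hρ hρ1 ha l => ?_⟩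
  have : NeZero d := ⟨by rintro rfl; simp at hρ1⟩
  have : NeZero m := ⟨by rintro rfl; simpa using ha.sum_eq_one⟩
  obtain rfl | hl := l.eq_zero_or_pos
  · exact ⟨1, fun _ => 1, fun _ _ => 0, isPOVM_one, by simp, fun k => k.elim0⟩
  obtain ⟨M, w, A, hM, hA, hA1, hAw⟩ := exists_compressed_card_le hl hρ hρ1 ha hs0 hs1
  obtain ⟨A', w', hA', h⟩ := exists_isPOVM_sum_opNorm_marginal_sub_le hρ hρ1 ha hA hA1 hη.le
    fun k j F hF hF1 => (hAw k j F hF hF1).trans hs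
  exact ⟨M + 1, A', w', hA', by exact_mod_cast hM, fun k => (h k).trans hη_le⟩

open POVMCompression in
theorem theorem2 (d m : ℕ) (ε : ℝ) (hε : 0 < ε) :
    ∃ C : ℝ, ∀ (ρ : Matrix (Fin d) (Fin d) ℂ) (a : Fin m → Matrix (Fin d) (Fin d) ℂ),
      IsFaithfulState ρ → IsPOVM a → ∀ l : ℕ,
        ∃ (M : ℕ) (A : Fin M → Matrix (Fin l → Fin d) (Fin l → Fin d) ℂ)
          (w : Fin M → Fin l → Fin m),
          IsPOVM A ∧
          (M : ℝ) ≤ Real.exp (l * entropyDefect ρ a + C * √(l : ℝ)) ∧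
          ∀ k : Fin l, ∑ j, opNorm (marginal ρ A w k j - a j) ≤ ε := by
  obtain ⟨C, hC⟩ := theorem2_general d m ε hε
  exact ⟨C, fun ρ a hρ => hC ρ a hρ.posDef.posSemidef hρ.trace_eq_one⟩
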